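/- Let $d \ge 1$, $T \in (0,\infty)$ and $G \in C^3(\mathbb{R})$. Let $M \subset \mathbb{R}^{d+1}$ be a $C^2$-embedded closed hypersurface, that is, a compact, connected $d$-dimensional $C^2$-submanifold without boundary that has a continuous unit normal. Let $$\theta \in C^1\big([0,T],C^0(M,\mathbb{R}^{d+1})\big) \cap C^0\big([0,T],C^2(M,\mathbb{R}^{d+1})\big)$$ be such that $\theta_t := \theta(t,\cdot)$ is an immersion for every $t \in [0,T]$; write $\Gamma(t) = \theta_t(M)$ for the resulting evolving immersed closed hypersurface, and let $\nu : [0,T] \times M \to \mathbb{R}^{d+1}$ be a continuous map such that $\nu(t,\cdot)$ is a unit normal of $\Gamma(t)$ for every $t$. All quantities on $\Gamma(t)$ are regarded as functions on $M$ via $\theta_t$, and $\int_{\Gamma(t)} f \, \mathrm{d}\mathcal{A}$ denotes the integral of $f : M \to \mathbb{R}$ over $M$ with respect to the area measure induced by the immersion $\theta_t$. Let $\nabla_\Gamma$, $\mathrm{div}_\Gamma$ and $\Delta_\Gamma = \mathrm{div}_\Gamma \nabla_\Gamma$ be the surface gradient, the surface divergence and the Laplace-Beltrami operator of $\Gamma(t)$,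 let $H = -\mathrm{div}_\Gamma \nu$ be the mean curvature, $V = \partial_t \theta \cdot \nu$ the normal velocity and $\partial^\square f = \partial_t f - \partial_t\theta \cdot \nabla_\Gamma f$ the normal time derivative. Theorem (Non-Increase of Energy). Let $c \in C^1\big([0,T],C^0(M)\big) \cap C^0\big([0,T],C^2(M)\big)$ be such that $(\Gamma,c)$ solves $$V = \big(G(c) - G'(c)c\big) H, \qquad \partial^\square c = \Delta_\Gamma \big(G'(c)\big) + cHV \qquad \text{on } [0,T] \times M.$$ Then the energy $E(t) := \int_{\Gamma(t)} G(c(t)) \, \mathrm{d}\mathcal{A}$ is non-increasing on $[0,T]$. Indeed, for every $t \in [0,T]$ the functions $G(c(t))$ and $|\nabla_\Gamma G'(c(t))|^2 + V(t)^2$ are integrable over $\Gamma(t)$, and $E$ is differentiable at $t$ relative to $[0,T]$ (one-sided at the end points) with $$\frac{\mathrm{d}E}{\mathrm{d}t}(t) = - \int_{\Gamma(t)} \Big( \big|\nabla_\Gamma G'(c)\big|^2 + V^2 \Big) \, \mathrm{d}\mathcal{A}.$$ -/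

import Mathlib

open Set Filter Topology MeasureTheory
open scoped RealInnerProductSpace BoundedContinuousFunction

namespace SurfaceFlow

/-- `ℝⁿ` with its Euclidean norm. -/
abbrev Euc (n : ℕ) : Type := EuclideanSpace ℝ (Fin n)

/-! ### Embedded closed hypersurfaces and functions on them -/

section Hypersurfaces

variable {d : ℕ} {M : Set (Euc (d + 1))}

/-- A `C²` local parametrization of the subset `M` of `ℝ^{d+1}`: a homeomorphism `e` from an open
subset `e.source` of `ℝ^d` onto a relatively open subset `e.target` of `M` which, as a map into
`ℝ^{d+1}`, is of class `C²` with injective differential. -/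
structure IsLocalParam (e : OpenPartialHomeomorph (Euc d) M) : Prop where
  contDiffOn : ContDiffOn ℝ 2 (fun x => (e x : Euc (d + 1))) e.source
  injective : ∀ x ∈ e.source, Function.Injective (fderiv ℝ (fun y => (e y : Euc (d + 1))) x)

/-- `f : M → F` is of class `C^k` (meant for `k ≤ 2`). -/
def IsCk {F : Type*} [NormedAddCommGroup F] [NormedSpace ℝ F] (k : ℕ) (f : M → F) : Prop :=
  ∀ e : OpenPartialHomeomorph (Euc d) M, IsLocalParam e → ContDiffOn ℝ k (f ∘ e) e.source

/-- A `C²` map `θ : M → ℝ^{d+1}` whose differential is injective at every point. -/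
structure IsImmersion (θ : M → Euc (d + 1)) : Prop where
  isC2 : IsCk 2 θ
  injective : ∀ e : OpenPartialHomeomorph (Euc d) M, IsLocalParam e →
    ∀ x ∈ e.source, Function.Injective (fderiv ℝ (θ ∘ e) x)

/-- `ν : M → ℝ^{d+1}` is a continuous unit normal of the immersed hypersurface `θ(M)`: at each point
`p` it has length one and is orthogonal to the tangent space `dθ_p(T_p M)`. -/
structure IsUnitNormal (θ ν : M → Euc (d + 1)) : Prop where
  continuous : Continuous ν
  norm_eq_one : ∀ p, ‖ν p‖ = 1
  orthogonal : ∀ e : OpenPartialHomeomorph (Euc d) M, IsLocalParam e →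
    ∀ x ∈ e.source, ∀ v : Euc d, ⟪ν (e x), fderiv ℝ (θ ∘ e) x v⟫ = 0

variable (M) in
/-- A `C²`-embedded closed hypersurface `M ⊂ ℝ^{d+1}`: a `d`-dimensional `C²` submanifold (without
boundary) that has a continuous unit normal and is connected and compact. -/
structure IsClosedHypersurface : Prop where
  exists_param : ∀ p : M, ∃ e : OpenPartialHomeomorph (Euc d) M, IsLocalParam e ∧ p ∈ e.target
  exists_normal : ∃ ν : M → Euc (d + 1), IsUnitNormal (fun p : M => (p : Euc (d + 1))) ν
  isConnected : IsConnected M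
  isCompact : IsCompact M

end Hypersurfaces

noncomputable section

/-! ### Differential operators and integration on an immersed hypersurface `Σ = θ(M)`

All quantities are pulled back to the reference surface `M`. -/

section Operators

variable {d : ℕ} {M : Set (Euc (d + 1))}

/-- The surface gradient of `u` with respect to the parametrized hypersurface `X : ℝ^d → ℝ^{d+1}` at
the parameter `x`: with `A = dX_x`, it is `A (AᵀA)⁻¹ ∇u(x)`, in coordinates `g^{ij} ∂ᵢu ∂ⱼX`. It is
the tangent vector `w` with `⟪w, A v⟫ = du_x(v)` for all `v`. -/
def paramGrad (X : Euc d → Euc (d + 1)) (u : Euc d → ℝ) (x : Euc d) : Euc (d + 1) :=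
  let A : Euc d →L[ℝ] Euc (d + 1) := fderiv ℝ X x
  A ((A.adjoint ∘L A).inverse (gradient u x))

open Classical in
/-- The surface gradient `∇_Σ f` of `f : M → ℝ` for the immersed hypersurface `Σ = θ(M)`, computed at
each point in some local parametrization of `M` around it (its value does not depend on which). -/
def surfaceGrad (θ : M → Euc (d + 1)) (f : M → ℝ) (p : M) : Euc (d + 1) :=
  if h : ∃ e : OpenPartialHomeomorph (Euc d) M, IsLocalParam e ∧ p ∈ e.target then
    paramGrad (θ ∘ h.choose) (f ∘ h.choose) (h.choose.symm p)
  else 0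

/-- The surface divergence `div_Σ F = ∑ᵢ [∇_Σ Fᵢ]ᵢ` of `F : M → ℝ^{d+1}`. -/
def surfaceDiv (θ F : M → Euc (d + 1)) (p : M) : ℝ :=
  ∑ i : Fin (d + 1), surfaceGrad θ (fun q => F q i) p i

/-- The Laplace-Beltrami operator `Δ_Σ f = div_Σ (∇_Σ f)`. -/
def laplaceBeltrami (θ : M → Euc (d + 1)) (f : M → ℝ) (p : M) : ℝ :=
  surfaceDiv θ (surfaceGrad θ f) p

/-- The mean curvature `H = - div_Σ ν` with respect to the unit normal `ν`. -/
def meanCurvature (θ ν : M → Euc (d + 1)) (p : M) : ℝ :=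
  - surfaceDiv θ ν p

/-- The area element `√(det (dXᵀ dX))` of the parametrized hypersurface `X`. -/
def areaElement (X : Euc d → Euc (d + 1)) (x : Euc d) : ℝ :=
  √(((fderiv ℝ X x).adjoint ∘L (fderiv ℝ X x)).det)

/-- The `d`-dimensional area measure of the immersed hypersurface `θ(M)`, pulled back to `M` (so that
points of self-intersection are counted with multiplicity): on the image of each local
parametrization `e` of `M` it is the image under `e` of `areaElement (θ ∘ e) dx`. By the change of
variables formula these measures agree on overlaps, and the measure on `M` that restricts to each of
them is their supremum. -/
def areaMeasure (θ : M → Euc (d + 1)) : Measure M :=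
  ⨆ (e : OpenPartialHomeomorph (Euc d) M) (_ : IsLocalParam e),
    ((volume.withDensity fun x => ENNReal.ofReal (areaElement (θ ∘ e) x)).restrict e.source).map e

end Operators

/-! ### Evolving hypersurfaces and the system -/

section Evolution

variable {d : ℕ} {M : Set (Euc (d + 1))}

/-- `f ∈ C¹([0,T], C⁰(M))`: the curve `t ↦ f(t,·)` in the space of (bounded) continuous functions on
`M` with the supremum norm is continuously differentiable on `[0,T]`. -/
def IsC1C0 {F : Type*} [NormedAddCommGroup F] [NormedSpace ℝ F] (T : ℝ) (f : ℝ → M → F) : Prop :=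
  ∃ γ : ℝ → (M →ᵇ F), ContDiffOn ℝ 1 γ (Icc 0 T) ∧ ∀ t ∈ Icc 0 T, ∀ p, γ t p = f t p

/-- `f ∈ C⁰([0,T], C²(M))`: each `f(t,·)` is of class `C²` on `M`, and `t ↦ f(t,·)` is continuous for
the topology of `C²(M)`, i.e. uniform convergence, on compact sets in local parametrizations, of all
derivatives of order at most two. -/
def IsC0C2 {F : Type*} [NormedAddCommGroup F] [NormedSpace ℝ F] (T : ℝ) (f : ℝ → M → F) : Prop :=
  (∀ t ∈ Icc 0 T, IsCk 2 (f t)) ∧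
  ∀ e : OpenPartialHomeomorph (Euc d) M, IsLocalParam e →
    ∀ K ⊆ e.source, IsCompact K → ∀ j ≤ 2, ∀ t ∈ Icc 0 T,
      TendstoUniformlyOn (fun s => iteratedFDeriv ℝ j (f s ∘ e)) (iteratedFDeriv ℝ j (f t ∘ e))
        (𝓝[Icc 0 T] t) K

/-- `θ` is the global parametrization of a `C¹`-`C²`-evolving immersed hypersurface
`Γ(t) = θ(t,M)`, `t ∈ [0,T]`, with reference surface `M`. -/
structure IsEvolvingImmersed (T : ℝ) (θ : ℝ → M → Euc (d + 1)) : Prop where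
  isC1C0 : IsC1C0 T θ
  isC0C2 : IsC0C2 T θ
  isImmersion : ∀ t ∈ Icc 0 T, IsImmersion (θ t)

/-- `ν` is a normal of the evolving hypersurface: continuous on `[0,T] × M`, and `ν(t,·)` is a unit
normal of `Γ(t)` for every `t ∈ [0,T]`. -/
structure IsEvolvingNormal (T : ℝ) (θ ν : ℝ → M → Euc (d + 1)) : Prop where
  continuousOn : ContinuousOn (Function.uncurry ν) (Icc 0 T ×ˢ univ)
  isUnitNormal : ∀ t ∈ Icc 0 T, IsUnitNormal (θ t) (ν t)

/-- The partial time derivative of `f` on `[0,T]` (one-sided at the end points). -/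
def timeDeriv {F : Type*} [NormedAddCommGroup F] [NormedSpace ℝ F] (T : ℝ) (f : ℝ → M → F)
    (t : ℝ) (p : M) : F :=
  derivWithin (fun s => f s p) (Icc 0 T) t

/-- The normal velocity `V = ∂ₜθ · ν`. -/
def normalVelocity (T : ℝ) (θ ν : ℝ → M → Euc (d + 1)) (t : ℝ) (p : M) : ℝ :=
  ⟪timeDeriv T θ t p, ν t p⟫

/-- The normal time derivative `∂^□ f = ∂ₜ f - ∂ₜθ · ∇_Γ f`. -/
def normalTimeDeriv (T : ℝ) (θ : ℝ → M → Euc (d + 1)) (f : ℝ → M → ℝ) (t : ℝ) (p : M) : ℝ :=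
  timeDeriv T f t p - ⟪timeDeriv T θ t p, surfaceGrad (θ t) (f t) p⟫

/-- `(Γ, c)`, with `Γ(t) = θ(t,M)` and normal `ν`, is a solution on `[0,T]` of
`V = (G(c) - G'(c) c) H`, `∂^□ c = Δ_Γ (G'(c)) + c H V`. -/
structure IsSolution (G : ℝ → ℝ) (T : ℝ) (θ ν : ℝ → M → Euc (d + 1)) (c : ℝ → M → ℝ) : Prop where
  evolving : IsEvolvingImmersed T θ
  normal : IsEvolvingNormal T θ ν
  isC1C0 : IsC1C0 T c
  isC0C2 : IsC0C2 T c
  velocity_eq : ∀ t ∈ Icc 0 T, ∀ p : M,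
    normalVelocity T θ ν t p =
      (G (c t p) - deriv G (c t p) * c t p) * meanCurvature (θ t) (ν t) p
  diffusion_eq : ∀ t ∈ Icc 0 T, ∀ p : M,
    normalTimeDeriv T θ c t p =
      laplaceBeltrami (θ t) (fun q => deriv G (c t q)) p +
        c t p * meanCurvature (θ t) (ν t) p * normalVelocity T θ ν t p

/-- The energy `E(Γ(t), c(t)) = ∫_{Γ(t)} G(c(t))`. -/
def energy (G : ℝ → ℝ) (θ : ℝ → M → Euc (d + 1)) (c : ℝ → M → ℝ) (t : ℝ) : ℝ :=
  ∫ p, G (c t p) ∂(areaMeasure (θ t))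

/-- The dissipation density `|∇_Γ G'(c)|² + V²` at time `t`. -/
def dissipation (G : ℝ → ℝ) (T : ℝ) (θ ν : ℝ → M → Euc (d + 1)) (c : ℝ → M → ℝ) (t : ℝ)
    (p : M) : ℝ :=
  ‖surfaceGrad (θ t) (fun q => deriv G (c t q)) p‖ ^ 2 + normalVelocity T θ ν t p ^ 2

end Evolution

end

end SurfaceFlow

/-! Along the flow, `dE/dt = ∫ (G'(c) ∂ₜc - ∇_Γ G(c) · ∂ₜθ - G(c) H V)`: the area element has first
variation `div_Γ(∂ₜθ)`, and a surface integration by parts moves the derivative off `∂ₜθ`. Since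
`∇_Γ G(c) = G'(c) ∇_Γ c`, the integrand is `G'(c) ∂^□c - G(c) H V`. The two equations turn it into
`G'(c) Δ_Γ G'(c) - (G(c) - G'(c) c) H V = G'(c) Δ_Γ G'(c) - V²`, and Green's formula on the closed
surface gives minus the dissipation, which is nonpositive.

The difficulty is regularity: `∂ₜθ` is only continuous in space, so the area element, built from
`∇θ`, need not be differentiable in time, and differentiation under the integral is not available.
Instead, the localized energies at times `t` and `s` are joined by the straight segment between the
two configurations. The mean value theorem in the segment parameter, followed by integration by
parts in space, expresses their difference through `c_s - c_t` and `θ_s - θ_t` without derivatives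
of these differences (`exists_setIntegral_sub_eq_variationDensity`). After division by `s - t`
everything converges uniformly: the differences by the `C¹([0,T], C⁰)` hypothesis, the remaining
factors by the `C⁰([0,T], C²)` one (`hasDerivWithinAt_setIntegral_lagrangian`).

The limit contains the formal adjoint `divOp` of the linearized area functional. `divOp_areaFactor`
identifies it with the mean curvature, and `divOp_chart` adds the gradient of the weight. The same
adjoint, tested on a tangential field, yields Green's formula (`setIntegral_green`). A partition of
unity carries the chart statements over to `M`. -/

namespace SurfaceFlow

set_option linter.unusedSectionVars false

/-! ### Linear algebra of injective maps: pseudoinverse, area factor, trace -/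

section LinearAlgebra

open ContinuousLinearMap

variable {E F : Type*} [NormedAddCommGroup E] [InnerProductSpace ℝ E] [FiniteDimensional ℝ E]
  [NormedAddCommGroup F] [InnerProductSpace ℝ F] [FiniteDimensional ℝ F]

/-- The left inverse `(AᵀA)⁻¹Aᵀ` of an injective linear map `A`. -/
noncomputable def pinv (A : E →L[ℝ] F) : F →L[ℝ] E := (A.adjoint ∘L A).inverse ∘L A.adjoint

/-- The factor `√(det AᵀA)` by which `A` scales areas. -/
noncomputable def areaFactor (A : E →L[ℝ] F) : ℝ := √((A.adjoint ∘L A).det)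

theorem isInvertible_of_injective {S : E →L[ℝ] E} (hS : Function.Injective S) :
    S.IsInvertible := by
  refine ⟨(LinearEquiv.ofInjectiveEndo (S : E →ₗ[ℝ] E) hS).toContinuousLinearEquiv, ?_⟩
  ext x
  rfl

theorem isInvertible_adjoint_comp_self {A : E →L[ℝ] F} (hA : Function.Injective A) :
    (A.adjoint ∘L A).IsInvertible := by
  apply isInvertible_of_injective
  rw [injective_iff_map_eq_zero]
  intro x hx
  have h : ⟪(A.adjoint ∘L A) x, x⟫ = 0 := by rw [hx, inner_zero_left]
  rw [comp_apply, adjoint_inner_left, inner_self_eq_zero] at h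
  exact hA (by rw [h, map_zero])

theorem adjoint_apply_self_pinv {A : E →L[ℝ] F} (hA : Function.Injective A) (v : F) :
    A.adjoint (A (pinv A v)) = A.adjoint v :=
  (isInvertible_adjoint_comp_self hA).self_apply_inverse _

theorem pinv_apply_eq {A : E →L[ℝ] F} (hA : Function.Injective A) {v : F} {y : E}
    (h : A.adjoint (A y) = A.adjoint v) : pinv A v = y := by
  apply (isInvertible_adjoint_comp_self hA).injective
  rw [comp_apply, comp_apply, adjoint_apply_self_pinv hA, h]

theorem pinv_apply_self {A : E →L[ℝ] F} (hA : Function.Injective A) (y : E) :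
    pinv A (A y) = y := pinv_apply_eq hA rfl

theorem pinv_comp_self {A : E →L[ℝ] F} (hA : Function.Injective A) :
    pinv A ∘L A = ContinuousLinearMap.id ℝ E := by
  ext y
  exact pinv_apply_self hA y

theorem pinv_apply_eq_zero {A : E →L[ℝ] F} {n : F} (hn : ∀ v, ⟪n, A v⟫ = 0) : pinv A n = 0 := by
  have : A.adjoint n = 0 := ext_inner_right ℝ fun v => by
    rw [adjoint_inner_left, hn, inner_zero_left]
  rw [pinv, comp_apply, this, map_zero]

theorem inner_sub_self_pinv {A : E →L[ℝ] F} (hA : Function.Injective A) (n : F) (v : E) :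
    ⟪n - A (pinv A n), A v⟫ = 0 := by
  rw [← adjoint_inner_left, map_sub, adjoint_apply_self_pinv hA, sub_self, inner_zero_left]

/-- When `g` is a coordinate gradient, the left side pairs the surface gradient with `v`. This
identity is how surface gradients are evaluated throughout. -/
theorem inner_self_inverse_apply {A : E →L[ℝ] F} (hA : Function.Injective A) (g : E) (v : F) :
    ⟪A ((A.adjoint ∘L A).inverse g), v⟫ = ⟪g, pinv A v⟫ := by
  have h := (isInvertible_adjoint_comp_self hA).self_apply_inverse g
  rw [comp_apply] at h
  nth_rewrite 2 [← h]
  rw [adjoint_inner_left, ← adjoint_inner_right A, ← adjoint_inner_right A,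
    adjoint_apply_self_pinv hA]

/-- `A (pinv A v)` is the orthogonal projection of `v` onto the range of `A`, which does not change
when `A` is precomposed with an invertible `C`. This is the source of the chart independence of the
surface gradient. -/
theorem comp_pinv_comp {A : E →L[ℝ] F} (hA : Function.Injective A) {C : E →L[ℝ] E}
    (hC : Function.Injective C) (v : F) : C (pinv (A ∘L C) v) = pinv A v := by
  symm
  apply pinv_apply_eq hA
  have h := adjoint_apply_self_pinv (A := A ∘L C) (hA.comp hC) v
  obtain ⟨C', rfl⟩ := isInvertible_of_injective hC
  refine ext_inner_right ℝ fun w => ?_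
  obtain ⟨z, rfl⟩ := C'.surjective w
  have h' := congrArg (fun y => ⟪y, z⟫) h
  simpa only [adjoint_comp, comp_apply, adjoint_inner_left, ContinuousLinearEquiv.coe_coe] using h'

theorem det_adjoint_comp_self_nonneg (A : E →L[ℝ] F) : 0 ≤ (A.adjoint ∘L A).det := by
  have hp : LinearMap.IsPositive ((A.adjoint ∘L A : E →L[ℝ] E) : E →ₗ[ℝ] E) :=
    (isPositive_adjoint_comp_self A).toLinearMap
  rw [ContinuousLinearMap.det, hp.isSymmetric.det_eq_prod_eigenvalues rfl]
  exact Finset.prod_nonneg fun i _ => hp.nonneg_eigenvalues rfl i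

theorem det_ne_zero_of_isInvertible {S : E →L[ℝ] E} (hS : S.IsInvertible) : S.det ≠ 0 := by
  obtain ⟨e, rfl⟩ := hS
  exact (LinearEquiv.isUnit_det' e.toLinearEquiv).ne_zero

theorem det_adjoint_comp_self_pos {A : E →L[ℝ] F} (hA : Function.Injective A) :
    0 < (A.adjoint ∘L A).det :=
  (det_adjoint_comp_self_nonneg A).lt_of_ne'
    (det_ne_zero_of_isInvertible (isInvertible_adjoint_comp_self hA))

theorem areaFactor_pos {A : E →L[ℝ] F} (hA : Function.Injective A) : 0 < areaFactor A :=
  Real.sqrt_pos.2 (det_adjoint_comp_self_pos hA)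

theorem areaFactor_comp (A : E →L[ℝ] F) (C : E →L[ℝ] E) :
    areaFactor (A ∘L C) = |C.det| * areaFactor A := by
  have h1 : C.adjoint.det = C.det := by
    let b := stdOrthonormalBasis ℝ E
    rw [ContinuousLinearMap.det, ContinuousLinearMap.det, ← LinearMap.det_toMatrix b.toBasis,
      ← LinearMap.det_toMatrix b.toBasis (C : E →ₗ[ℝ] E), ← Matrix.det_transpose]
    congr 1
    ext i j
    simp [LinearMap.toMatrix_apply, OrthonormalBasis.repr_apply_apply, adjoint_inner_right,
      real_inner_comm]
  have h : ((A ∘L C).adjoint ∘L (A ∘L C)).det = C.det ^ 2 * (A.adjoint ∘L A).det := by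
    have : (A ∘L C).adjoint ∘L (A ∘L C) = C.adjoint ∘L (A.adjoint ∘L A) ∘L C := by
      rw [adjoint_comp]; rfl
    rw [this]
    have h2 : ∀ S T : E →L[ℝ] E, (S ∘L T).det = S.det * T.det := fun S T =>
      LinearMap.det_comp (S : E →ₗ[ℝ] E) (T : E →ₗ[ℝ] E)
    rw [h2, h2, h1]
    ring
  rw [areaFactor, areaFactor, h, Real.sqrt_mul (sq_nonneg _), Real.sqrt_sq_eq_abs]

theorem contDiff_adjoint {n : WithTop ℕ∞} :
    ContDiff ℝ n (fun A : E →L[ℝ] F => A.adjoint) := by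
  let L : (E →L[ℝ] F) →ₗ[ℝ] (F →L[ℝ] E) :=
    { toFun := fun A => A.adjoint
      map_add' := fun A B => by simp
      map_smul' := fun r A => by simp }
  exact (LinearMap.toContinuousLinearMap L).contDiff

theorem contDiff_adjoint_comp_self {n : WithTop ℕ∞} :
    ContDiff ℝ n (fun A : E →L[ℝ] F => A.adjoint ∘L A) :=
  contDiff_adjoint.clm_comp contDiff_id

theorem contDiff_det {n : WithTop ℕ∞} : ContDiff ℝ n (fun S : E →L[ℝ] E => S.det) := by
  have h : ∀ S : E →L[ℝ] E, S.det = ∑ σ : Equiv.Perm (Fin (Module.finrank ℝ E)),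
      (Equiv.Perm.sign σ : ℝ) *
        ∏ i, ⟪stdOrthonormalBasis ℝ E (σ i), S (stdOrthonormalBasis ℝ E i)⟫ := by
    intro S
    rw [ContinuousLinearMap.det, ← LinearMap.det_toMatrix (stdOrthonormalBasis ℝ E).toBasis,
      Matrix.det_apply']
    simp [LinearMap.toMatrix_apply, OrthonormalBasis.repr_apply_apply]
  simp_rw [h]
  refine ContDiff.sum fun σ _ => contDiff_const.mul (contDiff_prod fun i _ => ?_)
  exact contDiff_const.inner ℝ (contDiff_id.clm_apply contDiff_const)

theorem contDiffAt_areaFactor {n : WithTop ℕ∞} {A : E →L[ℝ] F} (hA : Function.Injective A) :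
    ContDiffAt ℝ n (areaFactor : (E →L[ℝ] F) → ℝ) A :=
  (contDiff_det.comp contDiff_adjoint_comp_self).contDiffAt.sqrt
    (det_adjoint_comp_self_pos hA).ne'

/-- Injectivity of `A` amounts to positivity of the continuous function `det AᵀA`. -/
theorem isOpen_setOf_injective : IsOpen {A : E →L[ℝ] F | Function.Injective A} := by
  have : {A : E →L[ℝ] F | Function.Injective A} = {A | 0 < (A.adjoint ∘L A).det} := by
    ext A
    refine ⟨fun h => det_adjoint_comp_self_pos h, fun h => ?_⟩
    rw [mem_ofPred_eq, injective_iff_map_eq_zero]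
    intro x hx
    have h1 : IsUnit (LinearMap.det ((A.adjoint ∘L A : E →L[ℝ] E) : E →ₗ[ℝ] E)) :=
      (ne_of_gt h : (A.adjoint ∘L A).det ≠ 0).isUnit
    have h2 := (LinearEquiv.ofIsUnitDet (v := (stdOrthonormalBasis ℝ E).toBasis)
      (v' := (stdOrthonormalBasis ℝ E).toBasis)
      (f := ((A.adjoint ∘L A : E →L[ℝ] E) : E →ₗ[ℝ] E)) (by simpa using h1)).injective
    apply h2
    simp [hx]
  rw [this]
  exact isOpen_lt continuous_const
    (contDiff_det.comp (contDiff_adjoint_comp_self (n := 0))).continuous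

theorem contDiffAt_inverse_adjoint_comp_self {n : WithTop ℕ∞} {A : E →L[ℝ] F}
    (hA : Function.Injective A) :
    ContDiffAt ℝ n (fun A : E →L[ℝ] F => (A.adjoint ∘L A).inverse) A := by
  have h := (isInvertible_adjoint_comp_self hA).contDiffAt_map_inverse (𝕜 := ℝ) (n := n)
  exact ContDiffAt.comp (g := ContinuousLinearMap.inverse) (f := fun A : E →L[ℝ] F => A.adjoint ∘L A)
    A h contDiff_adjoint_comp_self.contDiffAt

theorem contDiffAt_pinv {n : WithTop ℕ∞} {A : E →L[ℝ] F} (hA : Function.Injective A) :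
    ContDiffAt ℝ n (pinv : (E →L[ℝ] F) → (F →L[ℝ] E)) A :=
  (contDiffAt_inverse_adjoint_comp_self hA).clm_comp contDiff_adjoint.contDiffAt

/-- The trace of an endomorphism. -/
noncomputable def ctrace (S : E →L[ℝ] E) : ℝ := LinearMap.trace ℝ E (S : E →ₗ[ℝ] E)

/-- In a basis the determinant is a polynomial in `r` whose linear coefficient is the trace. -/
theorem hasDerivAt_det_one_add (C : E →L[ℝ] E) :
    HasDerivAt (fun r : ℝ => (1 + r • C).det) (ctrace C) 0 := by
  let b := (stdOrthonormalBasis ℝ E).toBasis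
  let M := LinearMap.toMatrix b b (C : E →ₗ[ℝ] E)
  let p : Polynomial ℝ := (1 + (Polynomial.X : Polynomial ℝ) • M.map Polynomial.C).det
  have h : ∀ r : ℝ, (1 + r • C).det = p.eval r := by
    intro r
    have : ((1 + r • C : E →L[ℝ] E) : E →ₗ[ℝ] E) = 1 + r • (C : E →ₗ[ℝ] E) := rfl
    rw [ContinuousLinearMap.det, this, ← LinearMap.det_toMatrix b, map_add, map_smul,
      LinearMap.toMatrix_one]
    simp only [p]
    rw [← Polynomial.coe_evalRingHom, RingHom.map_det]
    congr 1
    ext i j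
    by_cases hij : i = j <;> simp [M, hij, Matrix.map_apply] <;> ring
  have hp := p.hasDerivAt 0
  rw [Matrix.derivative_det_one_add_X_smul] at hp
  simp_rw [h, ctrace, LinearMap.trace_eq_matrix_trace ℝ b]
  exact hp

/-- Jacobi's formula, reduced to the identity by factoring `S + r C = S (1 + r S⁻¹ C)`. -/
theorem fderiv_det_apply {S : E →L[ℝ] E} (hS : S.IsInvertible) (C : E →L[ℝ] E) :
    fderiv ℝ (fun S : E →L[ℝ] E => S.det) S C = S.det * ctrace (S.inverse ∘L C) := by
  have h1 : HasFDerivAt (fun S : E →L[ℝ] E => S.det)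
      (fderiv ℝ (fun S : E →L[ℝ] E => S.det) S) (S + (0 : ℝ) • C) := by
    simpa using ((contDiff_det (n := 1)).differentiable (by simp) S).hasFDerivAt
  have h2 : HasDerivAt (fun r : ℝ => S + r • C) C 0 := by
    simpa using ((hasDerivAt_id (0 : ℝ)).smul_const C).const_add S
  have h3 := h1.comp_hasDerivAt 0 h2
  have h4 : ((fun S : E →L[ℝ] E => S.det) ∘ fun r : ℝ => S + r • C)
      = fun r => S.det * (1 + r • (S.inverse ∘L C)).det := by
    funext r
    have : S + r • C = S ∘L (1 + r • (S.inverse ∘L C)) := by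
      ext x
      simp [hS.self_apply_inverse]
    simp only [Function.comp]
    rw [this]
    exact LinearMap.det_comp _ _
  rw [h4] at h3
  exact h3.unique ((hasDerivAt_det_one_add _).const_mul _)

theorem ctrace_add (S T : E →L[ℝ] E) : ctrace (S + T) = ctrace S + ctrace T := by
  simp [ctrace]

theorem ctrace_comp_comm (S : E →L[ℝ] F) (T : F →L[ℝ] E) : ctrace (S ∘L T) = ctrace (T ∘L S) := by
  exact LinearMap.trace_comp_comm' (R := ℝ) (T : F →ₗ[ℝ] E) (S : E →ₗ[ℝ] F)

theorem ctrace_adjoint (S : E →L[ℝ] E) : ctrace S.adjoint = ctrace S := by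
  simp_rw [ctrace, LinearMap.trace_eq_sum_inner _ (stdOrthonormalBasis ℝ E)]
  refine Finset.sum_congr rfl fun i _ => ?_
  simp [adjoint_inner_right, real_inner_comm]

theorem ctrace_smulRight (ℓ : E →L[ℝ] ℝ) (v : E) : ctrace (ℓ.smulRight v) = ℓ v := by
  exact LinearMap.trace_smulRight (R := ℝ) (ℓ : E →ₗ[ℝ] ℝ) v

/-- First variation of area at the level of linear maps. The derivative of `AᵀA` is `AᵀB + BᵀA`;
after composition with `(AᵀA)⁻¹` both halves have the same trace, since one is the adjoint of the
other up to cyclic permutation. The resulting factor 2 cancels the 1/2 from the square root. -/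
theorem fderiv_areaFactor_apply {A : E →L[ℝ] F} (hA : Function.Injective A) (B : E →L[ℝ] F) :
    fderiv ℝ areaFactor A B = areaFactor A * ctrace (pinv A ∘L B) := by
  set S := A.adjoint ∘L A with hSdef
  have hS : S.IsInvertible := isInvertible_adjoint_comp_self hA
  have hadj : HasFDerivAt (fun A : E →L[ℝ] F => A.adjoint ∘L A)
      (fderiv ℝ (fun A : E →L[ℝ] F => A.adjoint ∘L A) (A + (0 : ℝ) • B)) (A + (0 : ℝ) • B) :=
    ((contDiff_adjoint_comp_self (n := 1)).differentiable (by simp) _).hasFDerivAt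
  have hl : HasDerivAt (fun r : ℝ => A + r • B) B 0 := by
    simpa using ((hasDerivAt_id (0 : ℝ)).smul_const B).const_add A
  have hQ : fderiv ℝ (fun A : E →L[ℝ] F => A.adjoint ∘L A) A B
      = A.adjoint ∘L B + B.adjoint ∘L A := by
    have h1 := hadj.comp_hasDerivAt 0 hl
    -- Along the line `A + r B` the map is a quadratic polynomial in `r`, so its derivative at 0 is
    -- the linear coefficient.
    have h2 : HasDerivAt (fun r : ℝ => S + r • (A.adjoint ∘L B + B.adjoint ∘L A)
        + (r ^ 2) • (B.adjoint ∘L B)) (A.adjoint ∘L B + B.adjoint ∘L A) 0 := by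
      have h := (((hasDerivAt_id (0 : ℝ)).smul_const
        (A.adjoint ∘L B + B.adjoint ∘L A)).const_add S).add
          (((hasDerivAt_id (0 : ℝ)).pow 2).smul_const (B.adjoint ∘L B))
      exact h.congr_deriv (by simp)
    have h3 : ((fun A : E →L[ℝ] F => A.adjoint ∘L A) ∘ fun r : ℝ => A + r • B)
        = fun r : ℝ => S + r • (A.adjoint ∘L B + B.adjoint ∘L A) + (r ^ 2) • (B.adjoint ∘L B) := by
      funext r
      ext x
      simp only [Function.comp, map_add, comp_apply, add_apply, smul_apply, hSdef, map_smulₛₗ,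
        smul_add, pow_two, mul_smul]
      simp
      abel
    rw [h3] at h1
    simpa using h1.unique h2
  have h0 : HasFDerivAt (fun A : E →L[ℝ] F => A.adjoint ∘L A)
      (fderiv ℝ (fun A : E →L[ℝ] F => A.adjoint ∘L A) A) A := by simpa using hadj
  have hdet : HasFDerivAt (fun S : E →L[ℝ] E => S.det)
      (fderiv ℝ (fun S : E →L[ℝ] E => S.det) S) S :=
    ((contDiff_det (n := 1)).differentiable (by simp) S).hasFDerivAt
  have hc := hdet.comp A h0
  have hne : ((fun S : E →L[ℝ] E => S.det) ∘ fun A : E →L[ℝ] F => A.adjoint ∘L A) A ≠ 0 :=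
    (det_adjoint_comp_self_pos hA).ne'
  have h1 : HasFDerivAt areaFactor _ A := hc.sqrt hne
  rw [h1.fderiv]
  simp only [smul_apply, comp_apply, smul_eq_mul]
  rw [hQ, fderiv_det_apply hS]
  have h2 : ctrace (S.inverse ∘L (A.adjoint ∘L B + B.adjoint ∘L A))
      = 2 * ctrace (pinv A ∘L B) := by
    rw [comp_add, ctrace_add, two_mul]
    congr 1
    rw [ctrace_comp_comm, ← ctrace_adjoint]
    congr 1
    refine ContinuousLinearMap.ext fun x => ext_inner_right ℝ fun y => ?_
    rw [adjoint_inner_left, comp_apply, comp_apply, adjoint_inner_right, real_inner_comm,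
      inner_self_inverse_apply hA, real_inner_comm]
    rfl
  rw [h2, areaFactor]
  have h3 := Real.sq_sqrt (det_adjoint_comp_self_nonneg A)
  have h4 := (areaFactor_pos hA).ne'
  rw [areaFactor] at h4
  simp only [Function.comp]
  rw [← hSdef] at h3 h4 ⊢
  field_simp
  rw [h3]

end LinearAlgebra

/-! ### Uniform convergence and parameter integrals over compact sets -/

section UniformLimits

variable {E : Type*} {ι : Type*} {l : Filter ι} {K : Set E}

theorem tendstoUniformlyOn_prodMk {Z Z' : Type*} [UniformSpace Z] [UniformSpace Z']
    {f : ι → E → Z} {g : E → Z} {f' : ι → E → Z'} {g' : E → Z'}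
    (h : TendstoUniformlyOn f g l K) (h' : TendstoUniformlyOn f' g' l K) :
    TendstoUniformlyOn (fun i x => (f i x, f' i x)) (fun x => (g x, g' x)) l K :=
  fun V hV => (h.prodMk h' V hV).diag_of_prod

theorem tendstoUniformlyOn_const {Z : Type*} [UniformSpace Z] (g : E → Z) :
    TendstoUniformlyOn (fun _ : ι => g) g l K :=
  fun _ hV => Eventually.of_forall fun _ _ _ => refl_mem_uniformity hV

/-- The weights `r i` may vary arbitrarily with `i`: they will come from a mean value theorem, which
gives no control beyond `[0, 1]`. -/
theorem tendstoUniformlyOn_segment {Z : Type*} [NormedAddCommGroup Z] [NormedSpace ℝ Z]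
    {f : ι → E → Z} {g : E → Z} (h : TendstoUniformlyOn f g l K) {r : ι → ℝ}
    (hr : ∀ i, r i ∈ Icc (0 : ℝ) 1) :
    TendstoUniformlyOn (fun i x => g x + r i • (f i x - g x)) g l K := by
  rw [Metric.tendstoUniformlyOn_iff] at *
  intro ε hε
  filter_upwards [h ε hε] with i hi x hx
  have h1 := hi x hx
  rw [dist_comm, dist_eq_norm] at h1 ⊢
  rw [add_sub_cancel_left, norm_smul, Real.norm_of_nonneg (hr i).1]
  exact (mul_le_of_le_one_left (norm_nonneg _) (hr i).2).trans_lt h1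

variable [TopologicalSpace E]

/-- Eventually all values lie in one closed ball, which is compact because `Z` is proper. There `Φ`
is bounded, and dominated convergence applies. -/
theorem tendsto_setIntegral_comp_of_tendstoUniformlyOn [MeasurableSpace E] [OpensMeasurableSpace E]
    [T2Space E] {μ : Measure E} [IsFiniteMeasureOnCompacts μ] [l.IsCountablyGenerated]
    {Z : Type*} [NormedAddCommGroup Z] [ProperSpace Z] {Φ : Z → ℝ} (hΦ : Continuous Φ)
    (hK : IsCompact K) {f : ι → E → Z} {g : E → Z} (h : TendstoUniformlyOn f g l K)
    (hg : ContinuousOn g K) (hf : ∀ᶠ i in l, ContinuousOn (f i) K) :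
    Tendsto (fun i => ∫ x in K, Φ (f i x) ∂μ) l (𝓝 (∫ x in K, Φ (g x) ∂μ)) := by
  obtain ⟨R, hR⟩ := hK.exists_bound_of_continuousOn hg
  obtain ⟨C, hC⟩ := (isCompact_closedBall (0 : Z) (R + 1)).exists_bound_of_continuousOn
    hΦ.continuousOn
  refine tendsto_integral_filter_of_dominated_convergence (fun _ => C) ?_ ?_ ?_ ?_
  · filter_upwards [hf] with i hi
    exact (hΦ.comp_continuousOn hi).aestronglyMeasurable_of_isCompact hK hK.measurableSet
  · filter_upwards [Metric.tendstoUniformlyOn_iff.1 h 1 one_pos] with i hi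
    refine (ae_restrict_iff' hK.measurableSet).2 (Eventually.of_forall fun x hx => hC _ ?_)
    rw [mem_closedBall_zero_iff]
    have h1 := hi x hx
    rw [dist_comm, dist_eq_norm] at h1
    have h2 := norm_add_le (f i x - g x) (g x)
    rw [sub_add_cancel] at h2
    linarith [hR x hx]
  · exact integrableOn_const hK.measure_lt_top.ne
  · refine (ae_restrict_iff' hK.measurableSet).2 (Eventually.of_forall fun x hx => ?_)
    exact (hΦ.tendsto _).comp (h.tendsto_at hx)

theorem hasDerivAt_setIntegral_of_continuousOn [MeasurableSpace E] [OpensMeasurableSpace E]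
    [T2Space E] {μ : Measure E} [IsFiniteMeasureOnCompacts μ]
    (hK : IsCompact K) {h h' : ℝ → E → ℝ}
    (hh : ContinuousOn (Function.uncurry h) (univ ×ˢ K))
    (hh' : ContinuousOn (Function.uncurry h') (univ ×ˢ K))
    (hd : ∀ x ∈ K, ∀ r, HasDerivAt (fun r => h r x) (h' r x) r) (r : ℝ) :
    HasDerivAt (fun r => ∫ x in K, h r x ∂μ) (∫ x in K, h' r x ∂μ) r := by
  have hsec : ∀ {g : ℝ → E → ℝ}, ContinuousOn (Function.uncurry g) (univ ×ˢ K) → ∀ s,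
      ContinuousOn (g s) K := fun {g} hg s =>
    hg.comp (f := fun x => (s, x)) (by fun_prop) fun x hx => ⟨mem_univ _, hx⟩
  obtain ⟨C, hC⟩ := ((isCompact_closedBall r 1).prod hK).exists_bound_of_continuousOn
    (hh'.mono (prod_mono (subset_univ _) subset_rfl))
  refine (hasDerivAt_integral_of_dominated_loc_of_deriv_le (bound := fun _ => C)
    (Metric.closedBall_mem_nhds r one_pos) ?_ ?_ ?_ ?_ ?_ ?_).2
  · exact Eventually.of_forall fun s =>
      (hsec hh s).aestronglyMeasurable_of_isCompact hK hK.measurableSet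
  · exact (hsec hh r).integrableOn_compact hK
  · exact (hsec hh' r).aestronglyMeasurable_of_isCompact hK hK.measurableSet
  · exact (ae_restrict_iff' hK.measurableSet).2
      (Eventually.of_forall fun x hx s hs => hC (s, x) ⟨hs, hx⟩)
  · exact integrableOn_const hK.measure_lt_top.ne
  · exact (ae_restrict_iff' hK.measurableSet).2
      (Eventually.of_forall fun x hx s _ => hd x hx s)

end UniformLimits

/-! ### The formal adjoint of the differential -/

section Divergence

variable {E F : Type*} [NormedAddCommGroup E] [InnerProductSpace ℝ E] [FiniteDimensional ℝ E]
  [NormedAddCommGroup F] [InnerProductSpace ℝ F] [FiniteDimensional ℝ F]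

/-- The divergence of a field of functionals on `E →L[ℝ] F` with differential `Q`: the formal
adjoint of the differential. -/
noncomputable def divOp (Q : E →L[ℝ] ((E →L[ℝ] F) →L[ℝ] ℝ)) : F →L[ℝ] ℝ :=
  ∑ j, (Q (stdOrthonormalBasis ℝ E j)) ∘L
    ContinuousLinearMap.smulRightL ℝ E F (innerSL ℝ (stdOrthonormalBasis ℝ E j))

theorem divOp_apply (Q : E →L[ℝ] ((E →L[ℝ] F) →L[ℝ] ℝ)) (y : F) :
    divOp Q y = ∑ j, Q (stdOrthonormalBasis ℝ E j)
      ((innerSL ℝ (stdOrthonormalBasis ℝ E j)).smulRight y) := by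
  simp [divOp]

theorem continuous_divOp :
    Continuous (divOp : (E →L[ℝ] ((E →L[ℝ] F) →L[ℝ] ℝ)) → (F →L[ℝ] ℝ)) :=
  continuous_finsetSum _ fun _ _ =>
    (continuous_id.clm_apply continuous_const).clm_comp continuous_const

theorem sum_smulRight_apply_basis (B : E →L[ℝ] F) :
    ∑ j, (innerSL ℝ (stdOrthonormalBasis ℝ E j)).smulRight (B (stdOrthonormalBasis ℝ E j)) = B := by
  ext x
  have := congrArg B ((stdOrthonormalBasis ℝ E).sum_repr' x)
  simpa [map_sum] using this

/-- Product rule: the divergence of the vector field with components `P (b_j ⊗ η)` is `divOp (DP) η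
+ P (Dη)`. -/
theorem divOp_fderiv_apply {P : E → ((E →L[ℝ] F) →L[ℝ] ℝ)} {η : E → F} {x : E}
    (hP : DifferentiableAt ℝ P x) (hη : DifferentiableAt ℝ η x) :
    divOp (fderiv ℝ P x) (η x) = ∑ j, fderiv ℝ (fun y => P y
      (ContinuousLinearMap.smulRightL ℝ E F (innerSL ℝ (stdOrthonormalBasis ℝ E j)) (η y))) x
        (stdOrthonormalBasis ℝ E j) - P x (fderiv ℝ η x) := by
  have hd : ∀ j, fderiv ℝ (fun y => P y
      (ContinuousLinearMap.smulRightL ℝ E F (innerSL ℝ (stdOrthonormalBasis ℝ E j)) (η y))) x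
        (stdOrthonormalBasis ℝ E j) = fderiv ℝ P x (stdOrthonormalBasis ℝ E j)
          ((innerSL ℝ (stdOrthonormalBasis ℝ E j)).smulRight (η x)) +
        P x ((innerSL ℝ (stdOrthonormalBasis ℝ E j)).smulRight
          (fderiv ℝ η x (stdOrthonormalBasis ℝ E j))) := by
    intro j
    set R := ContinuousLinearMap.smulRightL ℝ E F (innerSL ℝ (stdOrthonormalBasis ℝ E j)) with hR
    have h3 := hP.hasFDerivAt.clm_apply (R.hasFDerivAt.comp x hη.hasFDerivAt)
    have h4 : fderiv ℝ (fun y => P y (R (η y))) x = _ := h3.fderiv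
    rw [h4]
    simp [hR, add_comm]
  rw [Finset.sum_congr rfl fun j _ => hd j, Finset.sum_add_distrib, divOp_apply, ← map_sum,
    sum_smulRight_apply_basis, add_sub_cancel_right]

end Divergence

/-! ### Integration by parts on an open set -/

section Calculus

variable {E F : Type*} [NormedAddCommGroup E] [InnerProductSpace ℝ E] [FiniteDimensional ℝ E]
  [NormedAddCommGroup F] [InnerProductSpace ℝ F] [FiniteDimensional ℝ F]
  [MeasurableSpace E] [BorelSpace E] {μ : Measure E} [μ.IsAddHaarMeasure] {U K : Set E}

/-- Extension by zero from `K` is `C¹` with compact support, because it agrees with `g` on all of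
`U` and vanishes on the open complement of `K`. -/
theorem setIntegral_fderiv_apply_eq_zero (hU : IsOpen U) (hK : IsCompact K) (hKU : K ⊆ U)
    {g : E → ℝ} (hg : ContDiffOn ℝ 1 g U) (hg0 : ∀ x ∈ U \ K, g x = 0) (v : E) :
    ∫ x in K, fderiv ℝ g x v ∂μ = 0 := by
  set f : E → ℝ := K.indicator g with hf
  have hfU : ∀ x ∈ U, f =ᶠ[𝓝 x] g := fun x hx => by
    filter_upwards [hU.mem_nhds hx] with y hy
    by_cases hyK : y ∈ K
    · exact indicator_of_mem hyK g
    · rw [hf, indicator_of_notMem hyK, hg0 y ⟨hy, hyK⟩]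
  have hfK : ∀ x ∉ K, f =ᶠ[𝓝 x] fun _ => 0 := fun x hx => by
    filter_upwards [hK.isClosed.isOpen_compl.mem_nhds hx] with y hy
    exact indicator_of_notMem hy g
  have hf1 : ContDiff ℝ 1 f := by
    rw [contDiff_iff_contDiffAt]
    intro x
    by_cases hx : x ∈ K
    · exact ((hg x (hKU hx)).contDiffAt (hU.mem_nhds (hKU hx))).congr_of_eventuallyEq
        (hfU x (hKU hx))
    · exact contDiffAt_const.congr_of_eventuallyEq (hfK x hx)
  have hcf : HasCompactSupport f :=
    HasCompactSupport.intro hK fun x hx => indicator_of_notMem hx g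
  have hcf' : HasCompactSupport fun x => fderiv ℝ f x v := hcf.fderiv_apply ℝ v
  have hcont : Continuous fun x => fderiv ℝ f x v :=
    (hf1.continuous_fderiv (by simp)).clm_apply continuous_const
  -- Integration by parts against the constant function 1.
  have h1 := integral_mul_fderiv_eq_neg_fderiv_mul_of_integrable (μ := μ) (f := fun _ : E => (1 : ℝ))
    (g := f) (v := v) (by simp) (by simpa using hcont.integrable_of_hasCompactSupport hcf')
    (by simpa using hf1.continuous.integrable_of_hasCompactSupport hcf)
    (fun x _ => differentiableAt_const _) (fun x _ => hf1.differentiable (by simp) x)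
  have h2 : ∫ x, fderiv ℝ f x v ∂μ = 0 := by simpa using h1
  rw [← setIntegral_eq_integral_of_forall_compl_eq_zero (s := K)] at h2
  · rw [← h2]
    exact setIntegral_congr_fun hK.measurableSet fun x hx => by
      rw [(hfU x (hKU hx)).fderiv_eq]
  · intro x hx
    rw [(hfK x hx).fderiv_eq]
    simp

/-- The boundary term disappears through the vanishing of `P` alone, so `η` needs no support
condition. -/
theorem setIntegral_apply_fderiv_eq_neg_divOp (hU : IsOpen U) (hK : IsCompact K) (hKU : K ⊆ U)
    {P : E → ((E →L[ℝ] F) →L[ℝ] ℝ)} (hP : ContDiffOn ℝ 1 P U) (hP0 : ∀ x ∈ U \ K, P x = 0)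
    {η : E → F} (hη : ContDiffOn ℝ 1 η U) :
    ∫ x in K, P x (fderiv ℝ η x) ∂μ = - ∫ x in K, divOp (fderiv ℝ P x) (η x) ∂μ := by
  let b := stdOrthonormalBasis ℝ E
  let R : Fin (Module.finrank ℝ E) → F →L[ℝ] (E →L[ℝ] F) := fun j =>
    ContinuousLinearMap.smulRightL ℝ E F (innerSL ℝ (b j))
  let g : Fin (Module.finrank ℝ E) → E → ℝ := fun j x => P x (R j (η x))
  have hg : ∀ j, ContDiffOn ℝ 1 (g j) U := fun j =>
    hP.clm_apply ((R j).contDiff.comp_contDiffOn hη)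
  have hg0 : ∀ j, ∀ x ∈ U \ K, g j x = 0 := fun j x hx => by simp [g, hP0 x hx]
  have hsum : ∀ x ∈ K, P x (fderiv ℝ η x) + divOp (fderiv ℝ P x) (η x)
      = ∑ j, fderiv ℝ (g j) x (b j) := by
    intro x hx
    have hnx := hU.mem_nhds (hKU hx)
    rw [divOp_fderiv_apply ((hP.contDiffAt hnx).differentiableAt (by simp))
      ((hη.contDiffAt hnx).differentiableAt (by simp))]
    exact add_sub_cancel _ _
  have hcP : ContinuousOn (fun x => P x (fderiv ℝ η x)) K :=
    (hP.continuousOn.clm_apply (hη.continuousOn_fderiv_of_isOpen hU (by simp))).mono hKU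
  have hcd : ContinuousOn (fun x => divOp (fderiv ℝ P x) (η x)) K :=
    ((continuous_divOp.comp_continuousOn (hP.continuousOn_fderiv_of_isOpen hU (by simp))).clm_apply
      hη.continuousOn).mono hKU
  rw [eq_neg_iff_add_eq_zero, ← integral_add (hcP.integrableOn_compact hK)
    (hcd.integrableOn_compact hK), setIntegral_congr_fun hK.measurableSet hsum, integral_finsetSum]
  · exact Finset.sum_eq_zero fun j _ =>
      setIntegral_fderiv_apply_eq_zero hU hK hKU (hg j) (hg0 j) (b j)
  · intro j _
    exact ((((hg j).continuousOn_fderiv_of_isOpen hU (by simp)).clm_apply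
      continuousOn_const).mono hKU).integrableOn_compact hK

end Calculus

/-! ### First variation of a localized Lagrangian under weak time regularity -/

section FirstVariation

variable {E F : Type*} [NormedAddCommGroup E] [InnerProductSpace ℝ E] [FiniteDimensional ℝ E]
  [NormedAddCommGroup F] [InnerProductSpace ℝ F] [FiniteDimensional ℝ F]
  {U K : Set E} {G : ℝ → ℝ} {L : (E →L[ℝ] F) → ℝ}

theorem contDiffOn_smul_field {W : Type*} [NormedAddCommGroup W] [NormedSpace ℝ W]
    {n : WithTop ℕ∞} {f : E → ℝ} {g : E → W} (hf : ContDiffOn ℝ n f U) (hg : ContDiffOn ℝ n g U) :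
    ContDiffOn ℝ n (fun x => f x • g x) U := hf.smul hg

theorem hasFDerivAt_smul_field {W : Type*} [NormedAddCommGroup W] [NormedSpace ℝ W]
    {f : E → ℝ} {g : E → W} {f' : E →L[ℝ] ℝ} {g' : E →L[ℝ] W} {x : E} (hf : HasFDerivAt f f' x)
    (hg : HasFDerivAt g g' x) :
    HasFDerivAt (fun x => f x • g x) (f x • g' + f'.smulRight (g x)) x := hf.smul hg

theorem continuousOn_segment {W : Type*} [NormedAddCommGroup W] [NormedSpace ℝ W]
    {f g : E → W} {r : ℝ} (hf : ContinuousOn f K) (hg : ContinuousOn g K) :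
    ContinuousOn (fun x => f x + r • (g x - f x)) K := hf.add ((hg.sub hf).const_smul r)

/-- The momentum field `φ G(u) L'(A)` of the Lagrangian `φ G(u) L(A)`. -/
noncomputable def momentum (G : ℝ → ℝ) (L : (E →L[ℝ] F) → ℝ) (φ u : E → ℝ) (A : E → (E →L[ℝ] F))
    (x : E) : (E →L[ℝ] F) →L[ℝ] ℝ :=
  (φ x * G (u x)) • fderiv ℝ L (A x)

theorem contDiffOn_momentum (hG : ContDiff ℝ 1 G) (hL : ContDiff ℝ 2 L) {φ u : E → ℝ}
    {A : E → (E →L[ℝ] F)} (hφ : ContDiffOn ℝ 1 φ U) (hu : ContDiffOn ℝ 1 u U)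
    (hA : ContDiffOn ℝ 1 A U) : ContDiffOn ℝ 1 (momentum G L φ u A) U :=
  contDiffOn_smul_field (hφ.mul (hG.comp_contDiffOn hu))
    ((hL.fderiv_right (m := 1) (by norm_num)).comp_contDiffOn hA)

/-- The first variation density of the Lagrangian `φ G(u) L(A)`, as a function of the values and
first derivatives of `φ`, `u`, `A` and of the variations `q` and `y`. -/
noncomputable def variationDensity (G : ℝ → ℝ) (L : (E →L[ℝ] F) → ℝ)
    (z : ((ℝ × (E →L[ℝ] ℝ)) × (ℝ × (E →L[ℝ] ℝ))) ×
      (((E →L[ℝ] F) × (E →L[ℝ] (E →L[ℝ] F))) × (ℝ × F))) : ℝ :=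
  z.1.1.1 * (deriv G z.1.2.1 * z.2.2.1) * L z.2.1.1 -
    ∑ j, ((z.1.1.1 * G z.1.2.1) * fderiv ℝ (fderiv ℝ L) z.2.1.1
        (z.2.1.2 (stdOrthonormalBasis ℝ E j))
        (ContinuousLinearMap.smulRightL ℝ E F (innerSL ℝ (stdOrthonormalBasis ℝ E j)) z.2.2.2) +
      (z.1.1.1 * (deriv G z.1.2.1 * z.1.2.2 (stdOrthonormalBasis ℝ E j)) +
        G z.1.2.1 * z.1.1.2 (stdOrthonormalBasis ℝ E j)) * fderiv ℝ L z.2.1.1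
        (ContinuousLinearMap.smulRightL ℝ E F (innerSL ℝ (stdOrthonormalBasis ℝ E j)) z.2.2.2))

theorem continuous_variationDensity (hG : ContDiff ℝ 1 G) (hL : ContDiff ℝ 2 L) :
    Continuous (variationDensity G L) := by
  have hG0 := hG.continuous
  have hG1 := hG.continuous_deriv (by simp)
  have hL0 := hL.continuous
  have hL1 : Continuous (fderiv ℝ L) := hL.continuous_fderiv (by simp)
  have hL2 : Continuous (fderiv ℝ (fderiv ℝ L)) :=
    (hL.fderiv_right (m := 1) (by norm_num)).continuous_fderiv (by simp)
  unfold variationDensity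
  refine Continuous.sub (by fun_prop) (continuous_finsetSum _ fun j _ => ?_)
  have hR := (ContinuousLinearMap.smulRightL ℝ E F
    (innerSL ℝ (stdOrthonormalBasis ℝ E j))).continuous
  refine Continuous.add (Continuous.mul (by fun_prop) ?_) (Continuous.mul (by fun_prop) ?_)
  · exact ((hL2.comp (by fun_prop)).clm_apply (by fun_prop)).clm_apply (hR.comp (by fun_prop))
  · exact (hL1.comp (by fun_prop)).clm_apply (hR.comp (by fun_prop))

theorem variationDensity_smul (k : ℝ) (z₁ : (ℝ × (E →L[ℝ] ℝ)) × (ℝ × (E →L[ℝ] ℝ)))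
    (z₂ : (E →L[ℝ] F) × (E →L[ℝ] (E →L[ℝ] F))) (q : ℝ) (y : F) :
    variationDensity G L (z₁, (z₂, (k • q, k • y))) =
      k • variationDensity G L (z₁, (z₂, (q, y))) := by
  simp only [variationDensity, smul_eq_mul, map_smul, mul_sub, Finset.mul_sum]
  congr 1
  · ring
  · exact Finset.sum_congr rfl fun j _ => by ring

theorem fderiv_momentum (hG : ContDiff ℝ 1 G) (hL : ContDiff ℝ 2 L) {φ u : E → ℝ}
    {A : E → (E →L[ℝ] F)} {x : E} (hφ : DifferentiableAt ℝ φ x) (hu : DifferentiableAt ℝ u x)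
    (hA : DifferentiableAt ℝ A x) :
    fderiv ℝ (momentum G L φ u A) x =
      (φ x * G (u x)) • (fderiv ℝ (fderiv ℝ L) (A x) ∘L fderiv ℝ A x) +
      (φ x • (deriv G (u x) • fderiv ℝ u x) + G (u x) • fderiv ℝ φ x).smulRight
        (fderiv ℝ L (A x)) := by
  have h1 : HasFDerivAt (fderiv ℝ L) (fderiv ℝ (fderiv ℝ L) (A x)) (A x) :=
    ((hL.fderiv_right (m := 1) (by norm_num)).differentiable (by simp) _).hasFDerivAt
  have h2 : HasDerivAt G (deriv G (u x)) (u x) := (hG.differentiable (by simp) _).hasDerivAt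
  have h3 : HasFDerivAt (fun y => fderiv ℝ L (A y)) (fderiv ℝ (fderiv ℝ L) (A x) ∘L fderiv ℝ A x)
      x := HasFDerivAt.comp (g := fderiv ℝ L) x h1 hA.hasFDerivAt
  exact (hasFDerivAt_smul_field (W := (E →L[ℝ] F) →L[ℝ] ℝ) (f := fun y => φ y * G (u y))
    (g := fun y => fderiv ℝ L (A y)) (hφ.hasFDerivAt.mul (h2.comp_hasFDerivAt x hu.hasFDerivAt)) h3).fderiv

theorem variationDensity_eq (hG : ContDiff ℝ 1 G) (hL : ContDiff ℝ 2 L) {φ u : E → ℝ}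
    {A : E → (E →L[ℝ] F)} {x : E} (hφ : DifferentiableAt ℝ φ x) (hu : DifferentiableAt ℝ u x)
    (hA : DifferentiableAt ℝ A x) (q : ℝ) (y : F) :
    variationDensity G L (((φ x, fderiv ℝ φ x), (u x, fderiv ℝ u x)),
        ((A x, fderiv ℝ A x), (q, y))) =
      φ x * (deriv G (u x) * q) * L (A x) - divOp (fderiv ℝ (momentum G L φ u A) x) y := by
  rw [fderiv_momentum hG hL hφ hu hA, divOp_apply]
  rfl

variable [MeasurableSpace E] [BorelSpace E] {μ : Measure E} [μ.IsAddHaarMeasure]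

/-- The mean value theorem along the segment from `(u₀, X₀)` to `(u₁, X₁)` produces the term
`momentum (D(X₁ - X₀))`; integration by parts moves that derivative onto the momentum. The
differences `u₁ - u₀` and `X₁ - X₀` then enter linearly and undifferentiated, at the price of second
derivatives of the interpolated `X`. -/
theorem exists_setIntegral_sub_eq_variationDensity (hG : ContDiff ℝ 1 G) (hL : ContDiff ℝ 2 L)
    (hU : IsOpen U) (hK : IsCompact K) (hKU : K ⊆ U) {φ u₀ u₁ : E → ℝ} {X₀ X₁ : E → F}
    (hφ : ContDiffOn ℝ 1 φ U) (hφ0 : ∀ x ∈ U \ K, φ x = 0)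
    (hu₀ : ContDiffOn ℝ 1 u₀ U) (hu₁ : ContDiffOn ℝ 1 u₁ U)
    (hX₀ : ContDiffOn ℝ 2 X₀ U) (hX₁ : ContDiffOn ℝ 2 X₁ U) :
    ∃ r ∈ Icc (0 : ℝ) 1,
      ∫ x in K, φ x * (G (u₁ x) * L (fderiv ℝ X₁ x)) ∂μ -
        ∫ x in K, φ x * (G (u₀ x) * L (fderiv ℝ X₀ x)) ∂μ =
      ∫ x in K, variationDensity G L (((φ x, fderiv ℝ φ x),
          (u₀ x + r • (u₁ x - u₀ x), fderiv ℝ u₀ x + r • (fderiv ℝ u₁ x - fderiv ℝ u₀ x))),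
        ((fderiv ℝ X₀ x + r • (fderiv ℝ X₁ x - fderiv ℝ X₀ x),
          fderiv ℝ (fderiv ℝ X₀) x + r • (fderiv ℝ (fderiv ℝ X₁) x - fderiv ℝ (fderiv ℝ X₀) x)),
          (u₁ x - u₀ x, X₁ x - X₀ x))) ∂μ := by
  have hA₀ : ContDiffOn ℝ 1 (fderiv ℝ X₀) U := hX₀.fderiv_of_isOpen hU (by norm_num)
  have hA₁ : ContDiffOn ℝ 1 (fderiv ℝ X₁) U := hX₁.fderiv_of_isOpen hU (by norm_num)
  let u : ℝ → E → ℝ := fun r x => u₀ x + r • (u₁ x - u₀ x)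
  let A : ℝ → E → (E →L[ℝ] F) := fun r x => fderiv ℝ X₀ x + r • (fderiv ℝ X₁ x - fderiv ℝ X₀ x)
  let h : ℝ → E → ℝ := fun r x => φ x * (G (u r x) * L (A r x))
  -- The derivative of `h` in `r`, still containing `D(X₁ - X₀)`.
  let h' : ℝ → E → ℝ := fun r x => φ x * (deriv G (u r x) * (u₁ x - u₀ x)) * L (A r x) +
    momentum G L φ (u r) (A r) x (fderiv ℝ (X₁ - X₀) x)
  have hG1 := hG.continuous_deriv (by simp)
  have hL1 : Continuous (fderiv ℝ L) := hL.continuous_fderiv (by simp)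
  have hsnd : ∀ {Z : Type _} [TopologicalSpace Z] {g : E → Z}, ContinuousOn g U →
      ContinuousOn (fun q : ℝ × E => g q.2) (univ ×ˢ K) := fun hg =>
    hg.comp continuousOn_snd fun q hq => hKU hq.2
  have hcφ := hsnd hφ.continuousOn
  have hcu : ContinuousOn (fun q : ℝ × E => u q.1 q.2) (univ ×ˢ K) :=
    (hsnd hu₀.continuousOn).add
      (continuousOn_fst.smul ((hsnd hu₁.continuousOn).sub (hsnd hu₀.continuousOn)))
  have hcA : ContinuousOn (fun q : ℝ × E => A q.1 q.2) (univ ×ˢ K) := by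
    have h0 := hA₀.continuousOn.comp (s := univ ×ˢ K) (f := fun q : ℝ × E => q.2) continuousOn_snd
      fun q hq => hKU hq.2
    have h1 := hA₁.continuousOn.comp (s := univ ×ˢ K) (f := fun q : ℝ × E => q.2) continuousOn_snd
      fun q hq => hKU hq.2
    exact h0.add (continuousOn_fst.smul (h1.sub h0))
  have hdη : ContDiffOn ℝ 2 (X₁ - X₀) U := hX₁.sub hX₀
  have hcη : ContinuousOn (fun q : ℝ × E => fderiv ℝ (X₁ - X₀) q.2) (univ ×ˢ K) :=
    (hdη.continuousOn_fderiv_of_isOpen hU (by norm_num)).comp continuousOn_snd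
      fun q hq => hKU hq.2
  have hη : ∀ x ∈ K, fderiv ℝ (X₁ - X₀) x = fderiv ℝ X₁ x - fderiv ℝ X₀ x := fun x hx =>
    fderiv_sub (((hX₁ x (hKU hx)).contDiffAt (hU.mem_nhds (hKU hx))).differentiableAt (by simp))
      (((hX₀ x (hKU hx)).contDiffAt (hU.mem_nhds (hKU hx))).differentiableAt (by simp))
  have hch : ContinuousOn (Function.uncurry h) (univ ×ˢ K) :=
    hcφ.mul ((hG.continuous.comp_continuousOn hcu).mul (hL.continuous.comp_continuousOn hcA))
  have hch' : ContinuousOn (Function.uncurry h') (univ ×ˢ K) :=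
    ((hcφ.mul ((hG1.comp_continuousOn hcu).mul
      ((hsnd hu₁.continuousOn).sub (hsnd hu₀.continuousOn)))).mul
        (hL.continuous.comp_continuousOn hcA)).add
      (((hcφ.mul (hG.continuous.comp_continuousOn hcu)).smul
        (hL1.comp_continuousOn hcA)).clm_apply hcη)
  have hd : ∀ x ∈ K, ∀ r, HasDerivAt (fun r => h r x) (h' r x) r := by
    intro x hx r
    have h1 : HasDerivAt (fun r => u r x) (u₁ x - u₀ x) r := by
      simpa [u] using ((hasDerivAt_id r).smul_const (u₁ x - u₀ x)).const_add (u₀ x)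
    have h2 : HasDerivAt (fun r => A r x) (fderiv ℝ (X₁ - X₀) x) r := by
      rw [hη x hx]
      simpa [A] using ((hasDerivAt_id r).smul_const
        (fderiv ℝ X₁ x - fderiv ℝ X₀ x)).const_add (fderiv ℝ X₀ x)
    have h3 := (hG.differentiable (by simp) (u r x)).hasDerivAt.comp r h1
    have h4 := (hL.differentiable (by simp) (A r x)).hasFDerivAt.comp_hasDerivAt r h2
    refine ((h3.mul h4).const_mul (φ x)).congr_deriv ?_
    simp only [h', momentum, Function.comp, smul_apply, smul_eq_mul]
    ring
  have hder := hasDerivAt_setIntegral_of_continuousOn (μ := μ) hK hch hch' hd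
  obtain ⟨r, hr, hslope⟩ := exists_hasDerivAt_eq_slope (fun r => ∫ x in K, h r x ∂μ)
    (fun r => ∫ x in K, h' r x ∂μ) zero_lt_one (fun r _ => (hder r).continuousAt.continuousWithinAt)
    (fun r _ => hder r)
  refine ⟨r, Ioo_subset_Icc_self hr, ?_⟩
  have e0 : ∫ x in K, h 0 x ∂μ = ∫ x in K, φ x * (G (u₀ x) * L (fderiv ℝ X₀ x)) ∂μ := by
    simp [h, u, A]
  have e1 : ∫ x in K, h 1 x ∂μ = ∫ x in K, φ x * (G (u₁ x) * L (fderiv ℝ X₁ x)) ∂μ := by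
    simp [h, u, A]
  rw [e0, e1, sub_zero, div_one] at hslope
  rw [← hslope]
  have hur : ContDiffOn ℝ 1 (u r) U := hu₀.add (contDiffOn_smul_field contDiffOn_const (hu₁.sub hu₀))
  have hAr : ContDiffOn ℝ 1 (A r) U := hA₀.add (contDiffOn_smul_field contDiffOn_const (hA₁.sub hA₀))
  have hP := contDiffOn_momentum hG hL hφ hur hAr
  have hP0 : ∀ x ∈ U \ K, momentum G L φ (u r) (A r) x = 0 := fun x hx => by
    simp [momentum, hφ0 x hx]
  have hibp := setIntegral_apply_fderiv_eq_neg_divOp (μ := μ) hU hK hKU hP hP0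
    (hdη.of_le (by norm_num))
  have hsec : ∀ {g : ℝ × E → ℝ}, ContinuousOn g (univ ×ˢ K) →
      IntegrableOn (fun x => g (r, x)) K μ := fun {g} hg =>
    (hg.comp (f := fun x => (r, x)) (by fun_prop)
      fun x hx => ⟨mem_univ _, hx⟩).integrableOn_compact hK
  have hi1 := hsec ((hcφ.mul ((hG1.comp_continuousOn hcu).mul
      ((hsnd hu₁.continuousOn).sub (hsnd hu₀.continuousOn)))).mul
        (hL.continuous.comp_continuousOn hcA))
  have hi2 := hsec (((hcφ.mul (hG.continuous.comp_continuousOn hcu)).smul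
        (hL1.comp_continuousOn hcA)).clm_apply hcη)
  have hi3 : IntegrableOn (fun x => divOp (fderiv ℝ (momentum G L φ (u r) (A r)) x) ((X₁ - X₀) x))
      K μ :=
    (((continuous_divOp.comp_continuousOn (hP.continuousOn_fderiv_of_isOpen hU (by simp))).clm_apply
      hdη.continuousOn).mono hKU).integrableOn_compact hK
  have hsplit := integral_add hi1 hi2
  refine Eq.trans hsplit ?_
  refine Eq.trans (congrArg _ hibp) ?_
  rw [← sub_eq_add_neg]
  refine (integral_sub hi1 hi3).symm.trans (setIntegral_congr_fun hK.measurableSet fun x hx => ?_)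
  have hnx := hU.mem_nhds (hKU hx)
  have d1 := ((hφ x (hKU hx)).contDiffAt hnx).differentiableAt (by simp)
  have d2 := ((hur x (hKU hx)).contDiffAt hnx).differentiableAt (by simp)
  have d3 := ((hAr x (hKU hx)).contDiffAt hnx).differentiableAt (by simp)
  have du0 := ((hu₀ x (hKU hx)).contDiffAt hnx).differentiableAt (by simp)
  have du1 := ((hu₁ x (hKU hx)).contDiffAt hnx).differentiableAt (by simp)
  have dA0 := ((hA₀ x (hKU hx)).contDiffAt hnx).differentiableAt (by simp)
  have dA1 := ((hA₁ x (hKU hx)).contDiffAt hnx).differentiableAt (by simp)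
  have fu : fderiv ℝ (u r) x = fderiv ℝ u₀ x + r • (fderiv ℝ u₁ x - fderiv ℝ u₀ x) :=
    (du0.hasFDerivAt.add ((du1.hasFDerivAt.sub du0.hasFDerivAt).const_smul r)).fderiv
  have fA : fderiv ℝ (A r) x = fderiv ℝ (fderiv ℝ X₀) x +
      r • (fderiv ℝ (fderiv ℝ X₁) x - fderiv ℝ (fderiv ℝ X₀) x) :=
    (dA0.hasFDerivAt.add ((dA1.hasFDerivAt.sub dA0.hasFDerivAt).const_smul r)).fderiv
  rw [← fu, ← fA]
  exact (variationDensity_eq hG hL d1 d2 d3 _ _).symm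

/-- The difference quotient is an integral of the continuous function `variationDensity` at
arguments that converge uniformly on `K`. Convergence of `∂ₜX` in space derivatives is never needed.
-/
theorem hasDerivWithinAt_setIntegral_lagrangian (hG : ContDiff ℝ 1 G) (hL : ContDiff ℝ 2 L)
    (hU : IsOpen U) (hK : IsCompact K) (hKU : K ⊆ U) {φ : E → ℝ} {u : ℝ → E → ℝ} {X : ℝ → E → F}
    (hφ : ContDiffOn ℝ 1 φ U) (hφ0 : ∀ x ∈ U \ K, φ x = 0) {S : Set ℝ} {t : ℝ} (ht : t ∈ S)
    (hu : ∀ s ∈ S, ContDiffOn ℝ 1 (u s) U) (hX : ∀ s ∈ S, ContDiffOn ℝ 2 (X s) U)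
    (hu0 : TendstoUniformlyOn u (u t) (𝓝[S] t) K)
    (hu1 : TendstoUniformlyOn (fun s => fderiv ℝ (u s)) (fderiv ℝ (u t)) (𝓝[S] t) K)
    (hX1 : TendstoUniformlyOn (fun s => fderiv ℝ (X s)) (fderiv ℝ (X t)) (𝓝[S] t) K)
    (hX2 : TendstoUniformlyOn (fun s => fderiv ℝ (fderiv ℝ (X s))) (fderiv ℝ (fderiv ℝ (X t)))
      (𝓝[S] t) K)
    {q : E → ℝ} {Y : E → F} (hq : ContinuousOn q K) (hY : ContinuousOn Y K)
    (huq : TendstoUniformlyOn (fun s x => (s - t)⁻¹ • (u s x - u t x)) q (𝓝[S \ {t}] t) K)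
    (hXY : TendstoUniformlyOn (fun s x => (s - t)⁻¹ • (X s x - X t x)) Y (𝓝[S \ {t}] t) K) :
    HasDerivWithinAt (fun s => ∫ x in K, φ x * (G (u s x) * L (fderiv ℝ (X s) x)) ∂μ)
      (∫ x in K, (φ x * (deriv G (u t x) * q x) * L (fderiv ℝ (X t) x) -
        divOp (fderiv ℝ (momentum G L φ (u t) (fderiv ℝ (X t))) x) (Y x)) ∂μ) S t := by
  classical
  rw [hasDerivWithinAt_iff_tendsto_slope]
  have hA : ∀ s ∈ S, ContDiffOn ℝ 1 (fderiv ℝ (X s)) U := fun s hs =>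
    (hX s hs).fderiv_of_isOpen hU (by norm_num)
  -- For `s ∉ S` the dummy value `r = 0` makes `r` a function of all `s`, with values in `[0, 1]`.
  have hmvt : ∀ s, ∃ r : ℝ, r ∈ Icc (0 : ℝ) 1 ∧ (s ∈ S → _) := fun s => by
    by_cases hs : s ∈ S
    · obtain ⟨r, hr, h⟩ := exists_setIntegral_sub_eq_variationDensity (μ := μ) hG hL hU hK hKU hφ
        hφ0 (hu t ht) (hu s hs) (hX t ht) (hX s hs)
      exact ⟨r, hr, fun _ => h⟩
    · exact ⟨0, ⟨le_rfl, zero_le_one⟩, fun h => absurd h hs⟩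
  choose r hr hmvt using hmvt
  have hle : 𝓝[S \ {t}] t ≤ 𝓝[S] t := nhdsWithin_mono t sdiff_subset
  have z1 := tendstoUniformlyOn_segment (fun V hV => hle (hu0 V hV)) hr
  have z2 := tendstoUniformlyOn_segment (fun V hV => hle (hu1 V hV)) hr
  have z3 := tendstoUniformlyOn_segment (fun V hV => hle (hX1 V hV)) hr
  have z4 := tendstoUniformlyOn_segment (fun V hV => hle (hX2 V hV)) hr
  have z0 := tendstoUniformlyOn_const (l := 𝓝[S \ {t}] t) (K := K) fun x => (φ x, fderiv ℝ φ x)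
  have z5 := tendstoUniformlyOn_prodMk z0 (tendstoUniformlyOn_prodMk z1 z2)
  have z6 := tendstoUniformlyOn_prodMk (tendstoUniformlyOn_prodMk z3 z4)
    (tendstoUniformlyOn_prodMk huq hXY)
  have hz := tendstoUniformlyOn_prodMk z5 z6
  have cφ := hφ.continuousOn.mono hKU
  have cφ' : ContinuousOn (fderiv ℝ φ) K :=
    (hφ.continuousOn_fderiv_of_isOpen hU (by simp)).mono hKU
  have cu : ∀ s ∈ S, ContinuousOn (u s) K := fun s hs => (hu s hs).continuousOn.mono hKU
  have cu' : ∀ s ∈ S, ContinuousOn (fderiv ℝ (u s)) K := fun s hs =>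
    ((hu s hs).continuousOn_fderiv_of_isOpen hU (by simp)).mono hKU
  have cX : ∀ s ∈ S, ContinuousOn (X s) K := fun s hs => (hX s hs).continuousOn.mono hKU
  have cA : ∀ s ∈ S, ContinuousOn (fderiv ℝ (X s)) K := fun s hs =>
    (hA s hs).continuousOn.mono hKU
  have cA' : ∀ s ∈ S, ContinuousOn (fderiv ℝ (fderiv ℝ (X s))) K := fun s hs =>
    ((hA s hs).continuousOn_fderiv_of_isOpen hU (by simp)).mono hKU
  have c1 := (cφ.prodMk cφ').prodMk ((cu t ht).prodMk (cu' t ht))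
  have c2 := ((cA t ht).prodMk (cA' t ht)).prodMk (hq.prodMk hY)
  have hev : ∀ᶠ s in 𝓝[S \ {t}] t, s ∈ S := eventually_mem_nhdsWithin.mono fun _ h => h.1
  have hlim := tendsto_setIntegral_comp_of_tendstoUniformlyOn (μ := μ)
    (Z := ((ℝ × (E →L[ℝ] ℝ)) × (ℝ × (E →L[ℝ] ℝ))) ×
      (((E →L[ℝ] F) × (E →L[ℝ] (E →L[ℝ] F))) × (ℝ × F)))
    (continuous_variationDensity hG hL) hK hz (c1.prodMk c2) (by
      filter_upwards [hev] with s hs'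
      have e1 := (cφ.prodMk cφ').prodMk
        ((continuousOn_segment (r := r s) (cu t ht) (cu s hs')).prodMk
          (continuousOn_segment (r := r s) (cu' t ht) (cu' s hs')))
      have e2 := (continuousOn_segment (W := E →L[ℝ] F) (r := r s) (cA t ht) (cA s hs')).prodMk
        (continuousOn_segment (W := E →L[ℝ] E →L[ℝ] F) (r := r s) (cA' t ht) (cA' s hs'))
      have e3 := (((cu s hs').sub (cu t ht)).const_smul (s - t)⁻¹).prodMk
        (((cX s hs').sub (cX t ht)).const_smul (s - t)⁻¹)
      exact e1.prodMk (e2.prodMk e3))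
  refine (hlim.congr' ?_).trans_eq ?_
  -- Linearity of the density in its last two arguments absorbs the factor `(s - t)⁻¹`.
  · filter_upwards [self_mem_nhdsWithin] with s hs
    rw [slope, vsub_eq_sub, hmvt s hs.1, ← integral_smul]
    congr 1
    funext x
    exact variationDensity_smul _ _ _ _ _
  · congr 1
    refine setIntegral_congr_fun hK.measurableSet fun x hx => ?_
    have hnx := hU.mem_nhds (hKU hx)
    have d1 := ((hφ x (hKU hx)).contDiffAt hnx).differentiableAt (by simp)
    have d2 := ((hu t ht x (hKU hx)).contDiffAt hnx).differentiableAt (by simp)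
    have d3 := ((hA t ht x (hKU hx)).contDiffAt hnx).differentiableAt (by simp)
    exact variationDensity_eq hG hL d1 d2 d3 _ _

end FirstVariation

/-! ### Hypersurface geometry in one chart: the adjoint of the area variation -/

section ChartGeometry

variable {E F : Type*} [NormedAddCommGroup E] [InnerProductSpace ℝ E] [FiniteDimensional ℝ E]
  [NormedAddCommGroup F] [InnerProductSpace ℝ F] [FiniteDimensional ℝ F] {U : Set E} {X : E → F}

theorem eq_inner_smul_of_orthogonal_range (hEF : Module.finrank ℝ F = Module.finrank ℝ E + 1)
    {A : E →L[ℝ] F} (hA : Function.Injective A) {ν n : F} (hν : ‖ν‖ = 1)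
    (hνA : ∀ v, ⟪ν, A v⟫ = 0) (hnA : ∀ v, ⟪n, A v⟫ = 0) : n = ⟪ν, n⟫ • ν := by
  let R : Submodule ℝ F := LinearMap.range (A : E →ₗ[ℝ] F)
  have hR : Module.finrank ℝ R = Module.finrank ℝ E := LinearMap.finrank_range_of_inj hA
  have hR' : Module.finrank ℝ Rᗮ = 1 := by
    have := R.finrank_add_finrank_orthogonal
    omega
  have hmem : ∀ m : F, (∀ v, ⟪m, A v⟫ = 0) → m ∈ Rᗮ := by
    intro m hm
    rw [Submodule.mem_orthogonal']
    rintro _ ⟨v, rfl⟩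
    exact hm v
  have hν0 : (⟨ν, hmem ν hνA⟩ : Rᗮ) ≠ 0 := by
    intro h
    have : ν = 0 := congrArg Subtype.val h
    simp [this] at hν
  obtain ⟨k, hk⟩ := (finrank_eq_one_iff_of_nonzero' _ hν0).1 hR' ⟨n, hmem n hnA⟩
  have hk' : k • ν = n := congrArg Subtype.val hk
  rw [← hk', inner_smul_right, real_inner_self_eq_norm_sq, hν]
  simp

theorem eq_range_add_normal (hEF : Module.finrank ℝ F = Module.finrank ℝ E + 1)
    {A : E →L[ℝ] F} (hA : Function.Injective A) {ν : F} (hν : ‖ν‖ = 1)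
    (hνA : ∀ v, ⟪ν, A v⟫ = 0) (y : F) : y = A (pinv A y) + ⟪ν, y⟫ • ν := by
  have h := eq_inner_smul_of_orthogonal_range hEF hA hν hνA (inner_sub_self_pinv hA y)
  rw [inner_sub_right, hνA, sub_zero] at h
  rw [← h]
  abel

/-- The operator on the left has the form of the differential of a product of a scalar function with
a field of functionals. -/
theorem divOp_smul_add_smulRight (k : ℝ) (Q : E →L[ℝ] ((E →L[ℝ] F) →L[ℝ] ℝ)) (ℓ : E →L[ℝ] ℝ)
    (Λ : (E →L[ℝ] F) →L[ℝ] ℝ) (y : F) :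
    divOp (k • Q + ℓ.smulRight Λ) y = k * divOp Q y + Λ (ℓ.smulRight y) := by
  have h := sum_smulRight_apply_basis (ℓ.smulRight y)
  rw [← h, map_sum, divOp_apply, divOp_apply, Finset.mul_sum, ← Finset.sum_add_distrib]
  refine Finset.sum_congr rfl fun j _ => ?_
  have h2 : (innerSL ℝ (stdOrthonormalBasis ℝ E j)).smulRight
      (ℓ.smulRight y (stdOrthonormalBasis ℝ E j)) = ℓ (stdOrthonormalBasis ℝ E j) •
        (innerSL ℝ (stdOrthonormalBasis ℝ E j)).smulRight y := by
    ext x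
    simp [smul_smul, mul_comm]
  rw [h2, map_smul]
  rfl

theorem pinv_comp_smulRight (A : E →L[ℝ] F) (ℓ : E →L[ℝ] ℝ) (y : F) :
    pinv A ∘L ℓ.smulRight y = ℓ.smulRight (pinv A y) := by
  ext x
  simp

theorem fderiv_areaFactor_smulRight {A : E →L[ℝ] F} (hA : Function.Injective A) (ℓ : E →L[ℝ] ℝ)
    (y : F) : fderiv ℝ areaFactor A (ℓ.smulRight y) = areaFactor A * ℓ (pinv A y) := by
  rw [fderiv_areaFactor_apply hA, pinv_comp_smulRight, ctrace_smulRight]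

theorem contDiffAt_fderiv_areaFactor {n : WithTop ℕ∞} {A : E →L[ℝ] F}
    (hA : Function.Injective A) : ContDiffAt ℝ n (fderiv ℝ (areaFactor : (E →L[ℝ] F) → ℝ)) A :=
  (contDiffAt_areaFactor (n := n + 1) hA).fderiv_right le_rfl

theorem contDiffOn_fderiv_areaFactor_comp (hU : IsOpen U) (hX : ContDiffOn ℝ 2 X U)
    (hinj : ∀ x ∈ U, Function.Injective (fderiv ℝ X x)) :
    ContDiffOn ℝ 1 (fun y => fderiv ℝ areaFactor (fderiv ℝ X y)) U := fun x hx =>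
  ContDiffAt.comp_contDiffWithinAt (g := fderiv ℝ (areaFactor : (E →L[ℝ] F) → ℝ)) x
    (contDiffAt_fderiv_areaFactor (hinj x hx)) (hX.fderiv_of_isOpen hU (by norm_num) x hx)

theorem contDiffOn_areaFactor_comp (hU : IsOpen U) (hX : ContDiffOn ℝ 2 X U)
    (hinj : ∀ x ∈ U, Function.Injective (fderiv ℝ X x)) :
    ContDiffOn ℝ 1 (fun y => areaFactor (fderiv ℝ X y)) U := fun x hx =>
  ContDiffAt.comp_contDiffWithinAt (g := (areaFactor : (E →L[ℝ] F) → ℝ)) x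
    (contDiffAt_areaFactor (hinj x hx)) (hX.fderiv_of_isOpen hU (by norm_num) x hx)

/-- On `η = DX v` the area variation gives `area(DX) ⟨b_j, v⟩`, whose divergence is the derivative
of `area(DX)` along `v`. By the chain rule and the symmetry of `D²X` this equals the area variation
in the direction `Dη = D²X v`, and the two terms cancel. -/
theorem divOp_areaFactor_tangential (hU : IsOpen U) (hX : ContDiffOn ℝ 2 X U)
    (hinj : ∀ x ∈ U, Function.Injective (fderiv ℝ X x)) {x : E} (hx : x ∈ U) (v : E) :
    divOp (fderiv ℝ (fun y => fderiv ℝ areaFactor (fderiv ℝ X y)) x) (fderiv ℝ X x v) = 0 := by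
  have hnx := hU.mem_nhds hx
  have hA : DifferentiableAt ℝ (fderiv ℝ X) x :=
    ((hX.fderiv_of_isOpen (m := 1) hU (by norm_num)).contDiffAt hnx).differentiableAt (by simp)
  have hΛ := ((contDiffOn_fderiv_areaFactor_comp hU hX hinj).contDiffAt hnx).differentiableAt
    (by simp)
  have ha := ((contDiffOn_areaFactor_comp hU hX hinj).contDiffAt hnx).differentiableAt (by simp)
  have hη : HasFDerivAt (fun y => fderiv ℝ X y v) ((fderiv ℝ (fderiv ℝ X) x).flip v) x := by
    simpa using hA.hasFDerivAt.clm_apply (hasFDerivAt_const v x)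
  have hsymm : (fderiv ℝ (fderiv ℝ X) x).flip v = fderiv ℝ (fderiv ℝ X) x v := by
    ext w
    rw [ContinuousLinearMap.flip_apply]
    exact ((hX.contDiffAt hnx).isSymmSndFDerivAt (by simp)) w v
  rw [divOp_fderiv_apply hΛ hη.differentiableAt, hη.fderiv, hsymm]
  have hj : ∀ j, fderiv ℝ (fun y => fderiv ℝ areaFactor (fderiv ℝ X y)
      (ContinuousLinearMap.smulRightL ℝ E F (innerSL ℝ (stdOrthonormalBasis ℝ E j))
        (fderiv ℝ X y v))) x (stdOrthonormalBasis ℝ E j) =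
      ⟪stdOrthonormalBasis ℝ E j, v⟫ * fderiv ℝ (fun y => areaFactor (fderiv ℝ X y)) x
        (stdOrthonormalBasis ℝ E j) := by
    intro j
    have heq : (fun y => fderiv ℝ areaFactor (fderiv ℝ X y)
      (ContinuousLinearMap.smulRightL ℝ E F (innerSL ℝ (stdOrthonormalBasis ℝ E j))
        (fderiv ℝ X y v))) =ᶠ[𝓝 x] fun y =>
          areaFactor (fderiv ℝ X y) * ⟪stdOrthonormalBasis ℝ E j, v⟫ := by
      filter_upwards [hnx] with y hy
      refine (fderiv_areaFactor_smulRight (hinj y hy) _ _).trans ?_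
      rw [pinv_apply_self (hinj y hy)]
      rfl
    rw [heq.fderiv_eq, fderiv_mul_const ha]
    simp
  have hsum : ∑ j, ⟪stdOrthonormalBasis ℝ E j, v⟫ *
      fderiv ℝ (fun y => areaFactor (fderiv ℝ X y)) x (stdOrthonormalBasis ℝ E j) =
      fderiv ℝ (fun y => areaFactor (fderiv ℝ X y)) x v := by
    conv_rhs => rw [← (stdOrthonormalBasis ℝ E).sum_repr' v, map_sum]
    simp
  have hcomp : fderiv ℝ (fun y => areaFactor (fderiv ℝ X y)) x v =
      fderiv ℝ areaFactor (fderiv ℝ X x) (fderiv ℝ (fderiv ℝ X) x v) := by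
    have h1 : HasFDerivAt (areaFactor : (E →L[ℝ] F) → ℝ)
        (fderiv ℝ areaFactor (fderiv ℝ X x)) (fderiv ℝ X x) :=
      ((contDiffAt_areaFactor (n := 1) (hinj x hx)).differentiableAt (by simp)).hasFDerivAt
    have h2 : HasFDerivAt (fun y => areaFactor (fderiv ℝ X y)) _ x :=
      HasFDerivAt.comp (g := (areaFactor : (E →L[ℝ] F) → ℝ)) x h1 hA.hasFDerivAt
    rw [h2.fderiv]
    rfl
  rw [Finset.sum_congr rfl fun j _ => hj j, hsum, hcomp, sub_self]

/-- The pseudoinverse kills normal vectors, so the divergence term vanishes identically near `x` and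
only minus the area variation in the direction `Dν` remains. -/
theorem divOp_areaFactor_normal (hU : IsOpen U) (hX : ContDiffOn ℝ 2 X U)
    (hinj : ∀ x ∈ U, Function.Injective (fderiv ℝ X x)) {ν : E → F}
    (hν : ∀ x ∈ U, ∀ v, ⟪ν x, fderiv ℝ X x v⟫ = 0) {x : E} (hx : x ∈ U)
    (hdν : DifferentiableAt ℝ ν x) :
    divOp (fderiv ℝ (fun y => fderiv ℝ areaFactor (fderiv ℝ X y)) x) (ν x) =
      - (areaFactor (fderiv ℝ X x) * ctrace (pinv (fderiv ℝ X x) ∘L fderiv ℝ ν x)) := by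
  have hnx := hU.mem_nhds hx
  have hΛ := ((contDiffOn_fderiv_areaFactor_comp hU hX hinj).contDiffAt hnx).differentiableAt
    (by simp)
  rw [divOp_fderiv_apply hΛ hdν, ← fderiv_areaFactor_apply (hinj x hx), Finset.sum_eq_zero,
    zero_sub]
  intro j _
  have heq : (fun y => fderiv ℝ areaFactor (fderiv ℝ X y)
      (ContinuousLinearMap.smulRightL ℝ E F (innerSL ℝ (stdOrthonormalBasis ℝ E j)) (ν y)))
        =ᶠ[𝓝 x] fun _ => 0 := by
    filter_upwards [hnx] with y hy
    refine (fderiv_areaFactor_smulRight (hinj y hy) _ _).trans ?_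
    rw [pinv_apply_eq_zero (hν y hy), map_zero, mul_zero]
  rw [heq.fderiv_eq]
  simp

theorem divOp_areaFactor (hEF : Module.finrank ℝ F = Module.finrank ℝ E + 1) (hU : IsOpen U)
    (hX : ContDiffOn ℝ 2 X U) (hinj : ∀ x ∈ U, Function.Injective (fderiv ℝ X x)) {ν : E → F}
    (hν1 : ∀ x ∈ U, ‖ν x‖ = 1) (hν : ∀ x ∈ U, ∀ v, ⟪ν x, fderiv ℝ X x v⟫ = 0) {x : E} (hx : x ∈ U)
    (hdν : DifferentiableAt ℝ ν x) (y : F) :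
    divOp (fderiv ℝ (fun y => fderiv ℝ areaFactor (fderiv ℝ X y)) x) y =
      - (areaFactor (fderiv ℝ X x) * ctrace (pinv (fderiv ℝ X x) ∘L fderiv ℝ ν x)) *
        ⟪ν x, y⟫ := by
  conv_lhs => rw [eq_range_add_normal hEF (hinj x hx) (hν1 x hx) (hν x hx) y]
  rw [map_add, map_smul, divOp_areaFactor_tangential hU hX hinj hx,
    divOp_areaFactor_normal hU hX hinj hν hx hdν, smul_eq_mul]
  ring

theorem divOp_fderiv_smul_areaFactor (hU : IsOpen U) (hX : ContDiffOn ℝ 2 X U)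
    (hinj : ∀ x ∈ U, Function.Injective (fderiv ℝ X x)) {w : E → ℝ} {x : E} (hx : x ∈ U)
    (hw : DifferentiableAt ℝ w x) (y : F) :
    divOp (fderiv ℝ (fun y => w y • fderiv ℝ areaFactor (fderiv ℝ X y)) x) y =
      areaFactor (fderiv ℝ X x) * fderiv ℝ w x (pinv (fderiv ℝ X x) y) +
      w x * divOp (fderiv ℝ (fun y => fderiv ℝ areaFactor (fderiv ℝ X y)) x) y := by
  have hΛ := ((contDiffOn_fderiv_areaFactor_comp hU hX hinj).contDiffAt
    (hU.mem_nhds hx)).differentiableAt (by simp)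
  have h := (hasFDerivAt_smul_field (W := (E →L[ℝ] F) →L[ℝ] ℝ) hw.hasFDerivAt
    hΛ.hasFDerivAt).fderiv
  rw [h, divOp_smul_add_smulRight, fderiv_areaFactor_smulRight (hinj x hx)]
  ring

theorem contDiffOn_pinv_comp {n : WithTop ℕ∞} {A : E → (E →L[ℝ] F)} (hA : ContDiffOn ℝ n A U)
    (hinj : ∀ x ∈ U, Function.Injective (A x)) : ContDiffOn ℝ n (fun y => pinv (A y)) U :=
  fun x hx => ContDiffAt.comp_contDiffWithinAt (g := (pinv : (E →L[ℝ] F) → _)) x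
    (contDiffAt_pinv (hinj x hx)) (hA x hx)

/-- Near `x`, project the fixed vector `ν x` onto the normal line at `y` and normalize. This is `C¹`
because `DX` is, and continuity of `ν` excludes the opposite sign. -/
theorem contDiffOn_unitNormal (hEF : Module.finrank ℝ F = Module.finrank ℝ E + 1) (hU : IsOpen U)
    (hX : ContDiffOn ℝ 2 X U) (hinj : ∀ x ∈ U, Function.Injective (fderiv ℝ X x)) {ν : E → F}
    (hcν : ContinuousOn ν U) (hν1 : ∀ x ∈ U, ‖ν x‖ = 1)
    (hν : ∀ x ∈ U, ∀ v, ⟪ν x, fderiv ℝ X x v⟫ = 0) : ContDiffOn ℝ 1 ν U := by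
  intro x hx
  have hnx := hU.mem_nhds hx
  have hA : ContDiffOn ℝ 1 (fderiv ℝ X) U := hX.fderiv_of_isOpen hU (by norm_num)
  let N : E → F := fun y => ν x - fderiv ℝ X y (pinv (fderiv ℝ X y) (ν x))
  have hN : ContDiffOn ℝ 1 N U :=
    contDiffOn_const.sub (hA.clm_apply ((contDiffOn_pinv_comp hA hinj).clm_apply contDiffOn_const))
  have hNx : N x = ν x := by simp [N, pinv_apply_eq_zero (hν x hx)]
  have hpos : ∀ᶠ y in 𝓝 x, 0 < ⟪ν y, ν x⟫ := by
    have hc : ContinuousAt (fun y => ⟪ν y, ν x⟫) x :=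
      (hcν.continuousAt hnx).inner continuousAt_const
    refine hc.eventually (lt_mem_nhds ?_)
    change 0 < ⟪ν x, ν x⟫
    rw [real_inner_self_eq_norm_sq, hν1 x hx]
    norm_num
  have heq : ν =ᶠ[𝓝 x] fun y => ‖N y‖⁻¹ • N y := by
    filter_upwards [hnx, hpos] with y hy hy0
    have h1 := eq_inner_smul_of_orthogonal_range hEF (hinj y hy) (hν1 y hy) (hν y hy)
      (inner_sub_self_pinv (hinj y hy) (ν x))
    rw [inner_sub_right, hν y hy, sub_zero] at h1
    have h2 : N y = ⟪ν y, ν x⟫ • ν y := h1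
    rw [h2, norm_smul, hν1 y hy, mul_one, Real.norm_of_nonneg hy0.le, smul_smul,
      inv_mul_cancel₀ hy0.ne', one_smul]
  have hN0 : N x ≠ 0 := by
    rw [hNx]
    intro h
    have := hν1 x hx
    simp [h] at this
  have hNc := hN.contDiffAt hnx
  exact (((hNc.norm ℝ hN0).inv (norm_ne_zero_iff.2 hN0)).smul hNc).congr_of_eventuallyEq heq
    |>.contDiffWithinAt

end ChartGeometry

/-! ### The surface gradient in parameters -/

section ParamGrad

variable {d : ℕ} {X : Euc d → Euc (d + 1)} {U : Set (Euc d)}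

theorem inner_paramGrad {x : Euc d} (hX : Function.Injective (fderiv ℝ X x)) (u : Euc d → ℝ)
    (v : Euc (d + 1)) : ⟪paramGrad X u x, v⟫ = fderiv ℝ u x (pinv (fderiv ℝ X x) v) := by
  refine (inner_self_inverse_apply hX _ v).trans ?_
  simp [gradient]

theorem paramGrad_mem_range (u : Euc d → ℝ) (x : Euc d) :
    ∃ v, paramGrad X u x = fderiv ℝ X x v := ⟨_, rfl⟩

theorem paramGrad_comp {ψ : Euc d → Euc d} {u : Euc d → ℝ} {x : Euc d}
    (hX : Function.Injective (fderiv ℝ X (ψ x))) (hXd : DifferentiableAt ℝ X (ψ x))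
    (hu : DifferentiableAt ℝ u (ψ x)) (hψ : DifferentiableAt ℝ ψ x)
    (hψi : Function.Injective (fderiv ℝ ψ x)) :
    paramGrad (X ∘ ψ) (u ∘ ψ) x = paramGrad X u (ψ x) := by
  have h1 : fderiv ℝ (X ∘ ψ) x = fderiv ℝ X (ψ x) ∘L fderiv ℝ ψ x := fderiv_comp x hXd hψ
  refine ext_inner_right ℝ fun v => ?_
  rw [inner_paramGrad (by rw [h1]; exact hX.comp hψi), inner_paramGrad hX, fderiv_comp x hu hψ, h1,
    ContinuousLinearMap.comp_apply, comp_pinv_comp hX hψi]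

theorem contDiffOn_paramGrad {n m : WithTop ℕ∞} (hU : IsOpen U) (hX : ContDiffOn ℝ m X U)
    (hinj : ∀ x ∈ U, Function.Injective (fderiv ℝ X x)) {u : Euc d → ℝ}
    (hu : ContDiffOn ℝ m u U) (hnm : n + 1 ≤ m) : ContDiffOn ℝ n (paramGrad X u) U := by
  have hA : ContDiffOn ℝ n (fderiv ℝ X) U := hX.fderiv_of_isOpen hU hnm
  let L : (Euc d →L[ℝ] ℝ) →ₗ[ℝ] Euc d :=
    { toFun := fun ℓ => (InnerProductSpace.toDual ℝ (Euc d)).symm ℓ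
      map_add' := fun A B => by simp
      map_smul' := fun r A => by simp }
  have hg : ContDiffOn ℝ n (gradient u) U :=
    (LinearMap.toContinuousLinearMap L).contDiff.comp_contDiffOn (hu.fderiv_of_isOpen hU hnm)
  have hi : ContDiffOn ℝ n
      (fun y => ((fderiv ℝ X y).adjoint ∘L (fderiv ℝ X y)).inverse) U := fun x hx =>
    ContDiffAt.comp_contDiffWithinAt
      (g := fun A : Euc d →L[ℝ] Euc (d + 1) => (A.adjoint ∘L A).inverse) x
      (contDiffAt_inverse_adjoint_comp_self (hinj x hx)) (hA x hx)
  exact hA.clm_apply (hi.clm_apply hg)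

/-- The left side is the trace of `Dη ∘ pinv DX` in the standard basis of the ambient space;
cyclicity moves the trace to the parameter space. -/
theorem sum_paramGrad_eq_ctrace {x : Euc d} (hX : Function.Injective (fderiv ℝ X x))
    {η : Euc d → Euc (d + 1)} (hη : DifferentiableAt ℝ η x) :
    ∑ i, paramGrad X (fun y => η y i) x i = ctrace (pinv (fderiv ℝ X x) ∘L fderiv ℝ η x) := by
  rw [← ctrace_comp_comm, ctrace,
    LinearMap.trace_eq_sum_inner _ (EuclideanSpace.basisFun (Fin (d + 1)) ℝ)]
  refine Finset.sum_congr rfl fun i _ => ?_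
  have h1 : paramGrad X (fun y => η y i) x i =
      ⟪paramGrad X (fun y => η y i) x, EuclideanSpace.basisFun (Fin (d + 1)) ℝ i⟫ := by
    simp [EuclideanSpace.inner_single_right]
  have h2 : HasFDerivAt (fun y => η y i)
      ((EuclideanSpace.proj i : Euc (d + 1) →L[ℝ] ℝ) ∘L fderiv ℝ η x) x :=
    (EuclideanSpace.proj i : Euc (d + 1) →L[ℝ] ℝ).hasFDerivAt.comp x hη.hasFDerivAt
  rw [h1, inner_paramGrad hX, h2.fderiv]
  simp [EuclideanSpace.inner_single_left]

end ParamGrad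

/-! ### Transition maps and independence of the chart -/

section Charts

variable {d : ℕ} {M : Set (Euc (d + 1))} {e e' : OpenPartialHomeomorph (Euc d) M}

theorem IsLocalParam.contDiffAt (he : IsLocalParam e) {x : Euc d} (hx : x ∈ e.source) :
    ContDiffAt ℝ 2 (fun y => (e y : Euc (d + 1))) x :=
  he.contDiffOn.contDiffAt (e.open_source.mem_nhds hx)

theorem continuousAt_transition {x : Euc d} (hx : x ∈ e.source) (hx' : e x ∈ e'.target) :
    ContinuousAt (fun y => e'.symm (e y)) x :=
  ContinuousAt.comp (g := e'.symm) (e'.continuousAt_symm hx') (e.continuousAt hx)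

theorem comp_eventuallyEq_comp_transition {Z : Type*} (f : M → Z) {x : Euc d} (hx : x ∈ e.source)
    (hx' : e x ∈ e'.target) : f ∘ e =ᶠ[𝓝 x] (f ∘ e') ∘ fun y => e'.symm (e y) := by
  filter_upwards [(e.continuousAt hx).preimage_mem_nhds (e'.open_target.mem_nhds hx')] with y hy
  simp [e'.right_inv hy]

/-- With `A` the differential of `e'` at `x'`, the map `pinv A ∘ e'` has derivative the identity
there. Its local inverse from the inverse function theorem, applied to `pinv A ∘ e`, is the
transition map near `x`. -/
theorem differentiableAt_transition (he : IsLocalParam e) (he' : IsLocalParam e') {x : Euc d}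
    (hx : x ∈ e.source) (hx' : e x ∈ e'.target) :
    DifferentiableAt ℝ (fun y => e'.symm (e y)) x := by
  set x' := e'.symm (e x) with hx'def
  have hx's : x' ∈ e'.source := e'.map_target hx'
  set A := fderiv ℝ (fun y => (e' y : Euc (d + 1))) x' with hA
  have hinj : Function.Injective A := he'.injective x' hx's
  let h : Euc d → Euc d := fun y => pinv A (e' y)
  have hcd : ContDiffAt ℝ 2 h x' := (pinv A).contDiff.contDiffAt.comp x' (he'.contDiffAt hx's)
  have hder : HasFDerivAt h ((ContinuousLinearEquiv.refl ℝ (Euc d) : Euc d →L[ℝ] Euc d)) x' := by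
    have h1 := (pinv A).hasFDerivAt.comp x'
      ((he'.contDiffAt hx's).differentiableAt (by simp)).hasFDerivAt
    rw [← hA, pinv_comp_self hinj] at h1
    exact h1
  have hinv := hcd.to_localInverse hder (by simp)
  have hleft := (hcd.hasStrictFDerivAt' hder (by simp)).eventually_left_inverse
  have heq : (fun y => e'.symm (e y)) =ᶠ[𝓝 x]
      fun y => hcd.localInverse hder (by simp) (pinv A (e y)) := by
    filter_upwards [(continuousAt_transition hx hx').eventually hleft,
      (e.continuousAt hx).preimage_mem_nhds (e'.open_target.mem_nhds hx')] with y hy hy'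
    have h2 : h (e'.symm (e y)) = pinv A (e y) := by simp only [h]; rw [e'.right_inv hy']
    rw [h2] at hy
    exact hy.symm
  have h3 : h x' = pinv A (e x) := by simp only [h]; rw [hx'def, e'.right_inv hx']
  rw [h3] at hinv
  refine DifferentiableAt.congr_of_eventuallyEq ?_ heq
  exact (hinv.differentiableAt (by simp)).comp x
    ((pinv A).differentiableAt.comp x ((he.contDiffAt hx).differentiableAt (by simp)))

theorem fderiv_comp_transition {Z : Type*} [NormedAddCommGroup Z] [NormedSpace ℝ Z]
    (he : IsLocalParam e) (he' : IsLocalParam e') {f : M → Z} {x : Euc d}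
    (hx : x ∈ e.source) (hx' : e x ∈ e'.target)
    (hf : DifferentiableAt ℝ (f ∘ e') (e'.symm (e x))) :
    fderiv ℝ (f ∘ e) x =
      fderiv ℝ (f ∘ e') (e'.symm (e x)) ∘L fderiv ℝ (fun y => e'.symm (e y)) x := by
  rw [(comp_eventuallyEq_comp_transition f hx hx').fderiv_eq]
  exact fderiv_comp x hf (differentiableAt_transition he he' hx hx')

/-- Chain rule for the inclusion `M ⊂ ℝ^{d+1}`, whose differential in the chart `e` is injective. -/
theorem injective_fderiv_transition (he : IsLocalParam e) (he' : IsLocalParam e') {x : Euc d}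
    (hx : x ∈ e.source) (hx' : e x ∈ e'.target) :
    Function.Injective (fderiv ℝ (fun y => e'.symm (e y)) x) := by
  have h := fderiv_comp_transition (f := fun p : M => (p : Euc (d + 1))) he he' hx hx'
    ((he'.contDiffAt (e'.map_target hx')).differentiableAt (by simp))
  have h1 := he.injective x hx
  change Function.Injective (fderiv ℝ ((fun p : M => (p : Euc (d + 1))) ∘ e) x) at h1
  rw [h] at h1
  exact Function.Injective.of_comp h1

theorem IsCk.differentiableAt {F : Type*} [NormedAddCommGroup F] [NormedSpace ℝ F] {k : ℕ}
    {f : M → F} (hf : IsCk k f) (hk : 1 ≤ k) (he : IsLocalParam e) {x : Euc d}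
    (hx : x ∈ e.source) : DifferentiableAt ℝ (f ∘ e) x :=
  ((hf e he).contDiffAt (e.open_source.mem_nhds hx)).differentiableAt
    (by exact_mod_cast (Nat.one_le_iff_ne_zero.1 hk))

theorem paramGrad_congr {X X' : Euc d → Euc (d + 1)} {u u' : Euc d → ℝ} {x : Euc d}
    (hX : X =ᶠ[𝓝 x] X') (hu : u =ᶠ[𝓝 x] u') : paramGrad X u x = paramGrad X' u' x := by
  simp only [paramGrad, gradient, hX.fderiv_eq, hu.fderiv_eq]

theorem surfaceGrad_apply {θ : M → Euc (d + 1)} (hθ : IsImmersion θ) {f : M → ℝ} (hf : IsCk 1 f)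
    (he : IsLocalParam e) {x : Euc d} (hx : x ∈ e.source) :
    surfaceGrad θ f (e x) = paramGrad (θ ∘ e) (f ∘ e) x := by
  have h : ∃ e₀ : OpenPartialHomeomorph (Euc d) M, IsLocalParam e₀ ∧ e x ∈ e₀.target :=
    ⟨e, he, e.map_source hx⟩
  obtain ⟨h₀, hx₀⟩ := h.choose_spec
  rw [surfaceGrad, dif_pos h, paramGrad_congr (comp_eventuallyEq_comp_transition θ hx hx₀)
    (comp_eventuallyEq_comp_transition f hx hx₀)]
  have hs := h.choose.map_target hx₀
  exact (paramGrad_comp (hθ.injective _ h₀ _ hs) (hθ.isC2.differentiableAt (by norm_num) h₀ hs)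
    (hf.differentiableAt le_rfl h₀ hs) (differentiableAt_transition he h₀ hx hx₀)
    (injective_fderiv_transition he h₀ hx hx₀)).symm

theorem areaElement_comp_transition {θ : M → Euc (d + 1)} (hθ : IsImmersion θ)
    (he : IsLocalParam e) (he' : IsLocalParam e') {x : Euc d} (hx : x ∈ e.source)
    (hx' : e x ∈ e'.target) :
    areaElement (θ ∘ e) x = |(fderiv ℝ (fun y => e'.symm (e y)) x).det| *
      areaElement (θ ∘ e') (e'.symm (e x)) := by
  have h := fderiv_comp_transition he he' hx hx'
    (hθ.isC2.differentiableAt (by norm_num) he' (e'.map_target hx'))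
  have h1 := areaFactor_comp (fderiv ℝ (θ ∘ e') (e'.symm (e x)))
    (fderiv ℝ (fun y => e'.symm (e y)) x)
  rw [← h] at h1
  exact h1

theorem continuousOn_areaElement {θ : M → Euc (d + 1)} (hθ : IsImmersion θ)
    (he : IsLocalParam e) : ContinuousOn (areaElement (θ ∘ e)) e.source :=
  (contDiffOn_areaFactor_comp e.open_source (hθ.isC2 e he) (hθ.injective e he)).continuousOn

end Charts

/-! ### The area measure in charts -/

section AreaMeasure

variable {d : ℕ} {M : Set (Euc (d + 1))} {e e' : OpenPartialHomeomorph (Euc d) M}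
  {θ : M → Euc (d + 1)}

/-- The area measure of `θ(M)` in the local parametrization `e`. -/
noncomputable def paramMeasure (θ : M → Euc (d + 1)) (e : OpenPartialHomeomorph (Euc d) M) :
    Measure M :=
  ((volume.withDensity fun x => ENNReal.ofReal (areaElement (θ ∘ e) x)).restrict e.source).map e

theorem measurableSet_source_inter_preimage {s : Set M} (hs : MeasurableSet s) :
    MeasurableSet (e.source ∩ e ⁻¹' s) := by
  have h : Measurable (e.source.domRestrict e) :=
    (continuousOn_iff_continuous_domRestrict.1 e.continuousOn).measurable
  have h1 := e.open_source.measurableSet.subtype_image (h hs)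
  convert h1 using 1
  ext x
  simp [Set.domRestrict_apply, and_comm]

theorem paramMeasure_apply {s : Set M} (hs : MeasurableSet s) : paramMeasure θ e s =
    ∫⁻ x in e.source ∩ e ⁻¹' s, ENNReal.ofReal (areaElement (θ ∘ e) x) := by
  rw [paramMeasure, Measure.map_apply_of_aemeasurable
    (e.continuousOn.aemeasurable e.open_source.measurableSet) hs,
    Measure.restrict_apply' e.open_source.measurableSet, inter_comm,
    withDensity_apply _ (measurableSet_source_inter_preimage hs)]

theorem paramMeasure_inter_target {s : Set M} (hs : MeasurableSet s) :
    paramMeasure θ e (s ∩ e.target) = paramMeasure θ e s := by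
  rw [paramMeasure_apply hs, paramMeasure_apply (hs.inter e.open_target.measurableSet)]
  congr 2
  ext x
  simp only [mem_inter_iff, mem_preimage, and_congr_right_iff, and_iff_left_iff_imp]
  exact fun hx _ => e.map_source hx

/-- Change of variables under the transition map, whose Jacobian is exactly the ratio of the two
area elements. -/
theorem paramMeasure_eq_of_subset (hθ : IsImmersion θ) (he : IsLocalParam e)
    (he' : IsLocalParam e') {s : Set M} (hs : MeasurableSet s) (h : s ⊆ e.target)
    (h' : s ⊆ e'.target) : paramMeasure θ e s = paramMeasure θ e' s := by
  rw [paramMeasure_apply hs, paramMeasure_apply hs]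
  have himg : (fun y => e'.symm (e y)) '' (e.source ∩ e ⁻¹' s) = e'.source ∩ e' ⁻¹' s := by
    ext y
    constructor
    · rintro ⟨x, ⟨hx, hxs⟩, rfl⟩
      refine ⟨e'.map_target (h' hxs), ?_⟩
      rw [mem_preimage, e'.right_inv (h' hxs)]
      exact hxs
    · rintro ⟨hy, hys⟩
      refine ⟨e.symm (e' y), ⟨e.map_target (h hys), ?_⟩, ?_⟩
      · rw [mem_preimage, e.right_inv (h hys)]
        exact hys
      · simp only []
        rw [e.right_inv (h hys), e'.left_inv hy]
  have hinj : InjOn (fun y => e'.symm (e y)) (e.source ∩ e ⁻¹' s) := fun x hx y hy hxy =>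
    e.injOn hx.1 hy.1 (e'.symm.injOn (h' hx.2) (h' hy.2) hxy)
  rw [← himg, lintegral_image_eq_lintegral_abs_det_fderiv_mul volume
    (measurableSet_source_inter_preimage hs) (fun x hx =>
      (differentiableAt_transition he he' hx.1 (h' hx.2)).hasFDerivAt.hasFDerivWithinAt) hinj]
  refine setLIntegral_congr_fun (measurableSet_source_inter_preimage hs) fun x hx => ?_
  rw [areaElement_comp_transition hθ he he' hx.1 (h' hx.2), ENNReal.ofReal_mul (abs_nonneg _)]

theorem areaMeasure_apply_of_subset (hθ : IsImmersion θ) (he : IsLocalParam e) {s : Set M}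
    (hs : MeasurableSet s) (h : s ⊆ e.target) : areaMeasure θ s = paramMeasure θ e s := by
  have ht : MeasurableSet e.target := e.open_target.measurableSet
  apply le_antisymm
  -- A supremum of measures is bounded by any common upper bound. Making the bound infinite outside
  -- `e.target` leaves only the overlaps to compare.
  · have hle : areaMeasure θ ≤ paramMeasure θ e + (⊤ : Measure M).restrict e.targetᶜ := by
      refine iSup₂_le fun e' he' => Measure.le_iff.2 fun r hr => ?_
      change paramMeasure θ e' r ≤ _
      rw [← measure_inter_add_sdiff r ht, Measure.add_apply, Measure.restrict_apply hr,
        ← sdiff_eq]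
      refine add_le_add ?_ ?_
      · rw [← paramMeasure_inter_target (hr.inter ht), paramMeasure_eq_of_subset hθ he' he
          ((hr.inter ht).inter e'.open_target.measurableSet) inter_subset_right
          (inter_subset_left.trans inter_subset_right)]
        exact measure_mono (inter_subset_left.trans inter_subset_left)
      · exact Measure.le_iff'.1 le_top _
    refine (Measure.le_iff'.1 hle s).trans ?_
    rw [Measure.add_apply, Measure.restrict_apply hs, (disjoint_compl_right_iff_subset.2 h).inter_eq,
      measure_empty, add_zero]
  · exact Measure.le_iff'.1 (le_iSup₂ (f := fun (e : OpenPartialHomeomorph (Euc d) M)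
      (_ : IsLocalParam e) => paramMeasure θ e) e he) s

theorem restrict_areaMeasure_target (hθ : IsImmersion θ) (he : IsLocalParam e) :
    (areaMeasure θ).restrict e.target = paramMeasure θ e := by
  ext s hs
  rw [Measure.restrict_apply hs, areaMeasure_apply_of_subset hθ he
    (hs.inter e.open_target.measurableSet) inter_subset_right, paramMeasure_inter_target hs]

theorem integral_areaMeasure_eq (hθ : IsImmersion θ) (he : IsLocalParam e) {K : Set (Euc d)}
    (hKs : K ⊆ e.source) {f : M → ℝ} (hf : Continuous f) (hf0 : ∀ p, p ∉ e '' K → f p = 0) :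
    ∫ p, f p ∂(areaMeasure θ) = ∫ x in K, f (e x) * areaElement (θ ∘ e) x := by
  have hsrc := e.open_source.measurableSet
  have h1 : ∫ p in e.target, f p ∂(areaMeasure θ) = ∫ p, f p ∂(areaMeasure θ) :=
    setIntegral_eq_integral_of_forall_compl_eq_zero fun p hp => hf0 p fun ⟨x, hx, hxp⟩ =>
      hp (hxp ▸ e.map_source (hKs hx))
  rw [← h1, restrict_areaMeasure_target hθ he, paramMeasure, integral_map
    (e.continuousOn.aemeasurable hsrc) hf.aestronglyMeasurable, restrict_withDensity hsrc,
    integral_withDensity_eq_integral_toReal_smul₀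
      ((continuousOn_areaElement hθ he).aemeasurable hsrc).ennreal_ofReal
      (Eventually.of_forall fun _ => ENNReal.ofReal_lt_top)]
  have h2 : ∀ x, (ENNReal.ofReal (areaElement (θ ∘ e) x)).toReal • f (e x) =
      f (e x) * areaElement (θ ∘ e) x := fun x => by
    rw [ENNReal.toReal_ofReal (show 0 ≤ areaElement (θ ∘ e) x from Real.sqrt_nonneg _),
      smul_eq_mul, mul_comm]
  simp_rw [h2]
  refine setIntegral_eq_of_subset_of_forall_sdiff_eq_zero hsrc hKs fun x hx => ?_
  rw [hf0, zero_mul]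
  rintro ⟨y, hy, hyx⟩
  exact hx.2 (e.injOn (hKs hy) hx.1 hyx ▸ hy)

theorem areaMeasure_image_lt_top (hθ : IsImmersion θ) (he : IsLocalParam e) {K : Set (Euc d)}
    (hK : IsCompact K) (hKs : K ⊆ e.source) : areaMeasure θ (e '' K) < ⊤ := by
  have hc : IsCompact (e '' K) := hK.image_of_continuousOn (e.continuousOn.mono hKs)
  have hsub : e '' K ⊆ e.target := by
    rintro _ ⟨x, hx, rfl⟩
    exact e.map_source (hKs hx)
  have hset : e.source ∩ e ⁻¹' (e '' K) = K := by
    ext x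
    refine ⟨fun ⟨hx, y, hy, hyx⟩ => e.injOn (hKs hy) hx hyx ▸ hy, fun hx => ⟨hKs hx, x, hx, rfl⟩⟩
  rw [areaMeasure_apply_of_subset hθ he hc.measurableSet hsub,
    paramMeasure_apply hc.measurableSet, hset]
  have hi : IntegrableOn (areaElement (θ ∘ e)) K :=
    ((continuousOn_areaElement hθ he).mono hKs).integrableOn_compact hK
  exact hi.lintegral_lt_top

end AreaMeasure

/-! ### Partition of unity subordinate to charts -/

section PartitionOfUnity

variable {d : ℕ} {M : Set (Euc (d + 1))}

theorem isCk_comp_val {φ : Euc (d + 1) → ℝ} (hφ : ContDiff ℝ 2 φ) :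
    IsCk 2 (fun p : M => φ p) := fun _ he =>
  hφ.comp_contDiffOn he.contDiffOn

open scoped Manifold ContDiff in
-- A smooth partition of unity of the ambient space, restricted to `M`. The functions vanish near,
-- and not merely at, points outside `e i '' K i`, so that surface gradients of their products
-- vanish there too.
theorem IsClosedHypersurface.exists_partitionOfUnity (hM : IsClosedHypersurface M) :
    ∃ (ι : Type) (_ : Fintype ι) (e : ι → OpenPartialHomeomorph (Euc d) M)
      (K : ι → Set (Euc d)) (ψ : ι → M → ℝ), (∀ i, IsLocalParam (e i) ∧ IsCompact (K i) ∧
        K i ⊆ (e i).source ∧ IsCk 2 (ψ i) ∧ ∀ p ∉ e i '' K i, ψ i =ᶠ[𝓝 p] 0) ∧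
      ∀ p, ∑ i, ψ i p = 1 := by
  have : CompactSpace M := isCompact_iff_compactSpace.1 hM.isCompact
  choose e he hpe using hM.exists_param
  have hV : ∀ p, ∃ V : Set (Euc (d + 1)), IsOpen V ∧ Subtype.val ⁻¹' V = (e p).target := fun p =>
    isOpen_induced_iff.1 (e p).open_target
  choose V hVo hVe using hV
  obtain ⟨t, ht⟩ := hM.isCompact.elim_finite_subcover V hVo fun p hp =>
    mem_iUnion.2 ⟨⟨p, hp⟩, by
      have : (⟨p, hp⟩ : M) ∈ Subtype.val ⁻¹' V ⟨p, hp⟩ := by rw [hVe]; exact hpe _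
      exact this⟩
  obtain ⟨f, hf⟩ := SmoothPartitionOfUnity.exists_isSubordinate 𝓘(ℝ, Euc (d + 1))
    hM.isCompact.isClosed (fun i : Fin t.card => V (t.equivFin.symm i)) (fun i => hVo _) (by
      intro p hp
      obtain ⟨q, hq, hpq⟩ := mem_iUnion₂.1 (ht hp)
      exact mem_iUnion.2 ⟨t.equivFin ⟨q, hq⟩, by simpa using hpq⟩)
  let e' : Fin t.card → OpenPartialHomeomorph (Euc d) M := fun i => e (t.equivFin.symm i)
  have hsub : ∀ i, (Subtype.val ⁻¹' tsupport (f i) : Set M) ⊆ (e' i).target := fun i => by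
    rw [← hVe]
    exact preimage_mono (hf i)
  have himg : ∀ i, e' i '' ((e' i).symm '' (Subtype.val ⁻¹' tsupport (f i))) =
      Subtype.val ⁻¹' tsupport (f i) := fun i => (e' i).image_symm_image_of_subset_target (hsub i)
  refine ⟨Fin t.card, inferInstance, e', fun i => (e' i).symm '' (Subtype.val ⁻¹' tsupport (f i)),
    fun i p => f i p, fun i => ⟨he _, ?_, ?_, ?_, ?_⟩, fun p => ?_⟩
  · exact ((isClosed_tsupport _).preimage continuous_subtype_val).isCompact.image_of_continuousOn
      ((e' i).continuousOn_symm.mono (hsub i))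
  · rintro _ ⟨p, hp, rfl⟩
    exact (e' i).map_target (hsub i hp)
  · exact isCk_comp_val ((f i).contMDiff.contDiff.of_le
      (WithTop.coe_le_coe.2 (OrderTop.le_top (2 : ℕ∞))))
  · intro p hp
    rw [himg] at hp
    exact (continuous_subtype_val.tendsto p).eventually
      (notMem_tsupport_iff_eventuallyEq.1 hp)
  · rw [← finsum_eq_sum_of_fintype]
    exact f.sum_eq_one p.2

end PartitionOfUnity

/-! ### Global extension of functions smooth near a compact set -/

section Cutoff

variable {E : Type*} [NormedAddCommGroup E] [NormedSpace ℝ E] [FiniteDimensional ℝ E]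

open scoped Manifold ContDiff in
theorem exists_contDiff_eventuallyEq_nhdsSet {Ω C : Set E} (hΩ : IsOpen Ω) (hC : IsCompact C)
    (hCΩ : C ⊆ Ω) {f : E → ℝ} {n : ℕ} (hf : ContDiffOn ℝ n f Ω) :
    ∃ g : E → ℝ, ContDiff ℝ n g ∧ ∀ᶠ x in 𝓝ˢ C, g x = f x := by
  obtain ⟨D, hD, hCD, hDΩ⟩ := exists_compact_between hC hΩ hCΩ
  obtain ⟨χ, hχ1, hχ0, -⟩ := exists_contMDiffMap_one_nhds_of_subset_interior 𝓘(ℝ, E) (n := ⊤)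
    hC.isClosed hCD
  have hχ : ContDiff ℝ n χ := χ.contMDiff.contDiff.of_le
    (WithTop.coe_le_coe.2 (OrderTop.le_top (n : ℕ∞)))
  refine ⟨fun x => χ x * f x, ?_, hχ1.mono fun x hx => by simp only [hx, one_mul]⟩
  rw [contDiff_iff_contDiffAt]
  intro x
  by_cases hx : x ∈ D
  · exact hχ.contDiffAt.mul (hf.contDiffAt (hΩ.mem_nhds (hDΩ hx)))
  · refine (contDiffAt_const (c := (0 : ℝ))).congr_of_eventuallyEq ?_
    filter_upwards [hD.isClosed.isOpen_compl.mem_nhds hx] with y hy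
    rw [hχ0 y hy, zero_mul]

end Cutoff

/-! ### Consequences of the time regularity -/

section TimeRegularity

theorem tendstoUniformlyOn_of_dist_eq {α ι Z Z' : Type*} [PseudoMetricSpace Z]
    [PseudoMetricSpace Z'] {l : Filter ι} {K : Set α} {f : ι → α → Z} {g : α → Z}
    {f' : ι → α → Z'} {g' : α → Z'} (h : TendstoUniformlyOn f g l K)
    (hd : ∀ i x, dist (g' x) (f' i x) = dist (g x) (f i x)) : TendstoUniformlyOn f' g' l K := by
  rw [Metric.tendstoUniformlyOn_iff] at *
  simpa only [hd] using h

variable {E F : Type*} [NormedAddCommGroup E] [NormedSpace ℝ E] [NormedAddCommGroup F]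
  [NormedSpace ℝ F]

theorem dist_iteratedFDeriv_zero (f g : E → F) (x : E) :
    dist (iteratedFDeriv ℝ 0 f x) (iteratedFDeriv ℝ 0 g x) = dist (f x) (g x) := by
  rw [iteratedFDeriv_zero_eq_comp, iteratedFDeriv_zero_eq_comp]
  exact LinearIsometryEquiv.dist_map _ _ _

theorem dist_iteratedFDeriv_succ (n : ℕ) (f g : E → F) (x : E) :
    dist (iteratedFDeriv ℝ (n + 1) f x) (iteratedFDeriv ℝ (n + 1) g x) =
      dist (iteratedFDeriv ℝ n (fderiv ℝ f) x) (iteratedFDeriv ℝ n (fderiv ℝ g) x) := by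
  rw [iteratedFDeriv_succ_eq_comp_right, iteratedFDeriv_succ_eq_comp_right]
  exact LinearIsometryEquiv.dist_map _ _ _

variable {d : ℕ} {M : Set (Euc (d + 1))} {T : ℝ} {f : ℝ → M → F}
  {e : OpenPartialHomeomorph (Euc d) M} {K : Set (Euc d)} {t : ℝ}

theorem IsC0C2.tendstoUniformlyOn (hf : IsC0C2 T f) (he : IsLocalParam e) (hK : IsCompact K)
    (hKs : K ⊆ e.source) (ht : t ∈ Icc 0 T) :
    TendstoUniformlyOn (fun s => f s ∘ e) (f t ∘ e) (𝓝[Icc 0 T] t) K :=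
  tendstoUniformlyOn_of_dist_eq (hf.2 e he K hKs hK 0 (by norm_num) t ht) fun _ _ =>
    (dist_iteratedFDeriv_zero _ _ _).symm

theorem IsC0C2.tendstoUniformlyOn_fderiv (hf : IsC0C2 T f) (he : IsLocalParam e)
    (hK : IsCompact K) (hKs : K ⊆ e.source) (ht : t ∈ Icc 0 T) :
    TendstoUniformlyOn (fun s => fderiv ℝ (f s ∘ e)) (fderiv ℝ (f t ∘ e)) (𝓝[Icc 0 T] t) K :=
  tendstoUniformlyOn_of_dist_eq (hf.2 e he K hKs hK 1 (by norm_num) t ht) fun _ _ =>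
    ((dist_iteratedFDeriv_succ 0 _ _ _).trans (dist_iteratedFDeriv_zero _ _ _)).symm

theorem IsC0C2.tendstoUniformlyOn_fderiv_fderiv (hf : IsC0C2 T f) (he : IsLocalParam e)
    (hK : IsCompact K) (hKs : K ⊆ e.source) (ht : t ∈ Icc 0 T) :
    TendstoUniformlyOn (fun s => fderiv ℝ (fderiv ℝ (f s ∘ e))) (fderiv ℝ (fderiv ℝ (f t ∘ e)))
      (𝓝[Icc 0 T] t) K :=
  tendstoUniformlyOn_of_dist_eq (hf.2 e he K hKs hK 2 le_rfl t ht) fun _ _ =>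
    ((dist_iteratedFDeriv_succ 1 _ _ _).trans ((dist_iteratedFDeriv_succ 0 _ _ _).trans
      (dist_iteratedFDeriv_zero _ _ _))).symm

/-- Differentiability in the sup norm means uniform convergence of the difference quotients, and
evaluation at `p`, being continuous and linear, identifies the limit with the pointwise time
derivative. -/
theorem IsC1C0.exists_derivative (hT : 0 < T) (hf : IsC1C0 T f) (ht : t ∈ Icc 0 T) :
    ∃ g : M →ᵇ F, (∀ p, timeDeriv T f t p = g p) ∧
      TendstoUniformly (fun s p => (s - t)⁻¹ • (f s p - f t p)) g (𝓝[Icc 0 T \ {t}] t) := by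
  obtain ⟨γ, hγ, hγf⟩ := hf
  have hd : HasDerivWithinAt γ (derivWithin γ (Icc 0 T) t) (Icc 0 T) t :=
    ((hγ.differentiableOn (by simp)) t ht).hasDerivWithinAt
  refine ⟨derivWithin γ (Icc 0 T) t, fun p => ?_, ?_⟩
  · have h1 : HasDerivWithinAt (fun s => γ s p) (derivWithin γ (Icc 0 T) t p) (Icc 0 T) t :=
      ((BoundedContinuousFunction.evalCLM ℝ p : (M →ᵇ F) →L[ℝ] F).hasFDerivAt).comp_hasDerivWithinAt
        t hd
    exact (h1.congr (fun s hs => (hγf s hs p).symm) (hγf t ht p).symm).derivWithin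
      (uniqueDiffOn_Icc hT t ht)
  · rw [hasDerivWithinAt_iff_tendsto_slope] at hd
    have h2 := BoundedContinuousFunction.tendsto_iff_tendstoUniformly.1 hd
    intro V hV
    filter_upwards [h2 V hV, eventually_mem_nhdsWithin] with s hs1 hs p
    have h3 : slope γ t s p = (s - t)⁻¹ • (f s p - f t p) := by
      rw [slope, vsub_eq_sub]
      simp [hγf s hs.1 p, hγf t ht p]
    rw [← h3]
    exact hs1 p

theorem IsC1C0.continuous_timeDeriv (hT : 0 < T) (hf : IsC1C0 T f) (ht : t ∈ Icc 0 T) :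
    Continuous (timeDeriv T f t) := by
  obtain ⟨g, hg, -⟩ := hf.exists_derivative hT ht
  rw [funext hg]
  exact g.continuous

theorem IsC1C0.tendstoUniformlyOn_slope (hT : 0 < T) (hf : IsC1C0 T f) (ht : t ∈ Icc 0 T) :
    TendstoUniformlyOn (fun s x => (s - t)⁻¹ • ((f s ∘ e) x - (f t ∘ e) x))
      (timeDeriv T f t ∘ e) (𝓝[Icc 0 T \ {t}] t) K := by
  obtain ⟨g, hg, hlim⟩ := hf.exists_derivative hT ht
  rw [funext hg]
  exact (hlim.comp e).tendstoUniformlyOn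

theorem IsC1C0.continuous (hf : IsC1C0 T f) (ht : t ∈ Icc 0 T) : Continuous (f t) := by
  obtain ⟨γ, -, hγ⟩ := hf
  rw [← funext (hγ t ht)]
  exact (γ t).continuous

end TimeRegularity

/-! ### Surface calculus on `M` and Green's formula -/

section SurfaceCalculus

variable {d : ℕ} {M : Set (Euc (d + 1))} {e : OpenPartialHomeomorph (Euc d) M}
  {θ ν : M → Euc (d + 1)}

theorem IsCk.of_le {F : Type*} [NormedAddCommGroup F] [NormedSpace ℝ F] {k m : ℕ} {f : M → F}
    (hf : IsCk m f) (h : k ≤ m) : IsCk k f := fun e he => (hf e he).of_le (by exact_mod_cast h)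

theorem IsCk.mul {k : ℕ} {f g : M → ℝ} (hf : IsCk k f) (hg : IsCk k g) :
    IsCk k (fun p => f p * g p) := fun e he => (hf e he).mul (hg e he)

theorem IsCk.comp_contDiff {k : ℕ} {G : ℝ → ℝ} (hG : ContDiff ℝ k G) {f : M → ℝ}
    (hf : IsCk k f) : IsCk k (fun p => G (f p)) := fun e he => hG.comp_contDiffOn (hf e he)

theorem IsCk.apply {k : ℕ} {η : M → Euc (d + 1)} (hη : IsCk k η) (i : Fin (d + 1)) :
    IsCk k (fun p => η p i) := fun e he =>
  (EuclideanSpace.proj i : Euc (d + 1) →L[ℝ] ℝ).contDiff.comp_contDiffOn (hη e he)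

theorem IsClosedHypersurface.continuous_of_chart (hM : IsClosedHypersurface M) {Z : Type*}
    [TopologicalSpace Z] {f : M → Z}
    (hf : ∀ e : OpenPartialHomeomorph (Euc d) M, IsLocalParam e → ContinuousOn (f ∘ e) e.source) :
    Continuous f := by
  rw [continuous_iff_continuousAt]
  intro p
  obtain ⟨e, he, hp⟩ := hM.exists_param p
  have h1 : ContinuousAt ((f ∘ e) ∘ e.symm) p :=
    ((hf e he).continuousAt (e.open_source.mem_nhds (e.map_target hp))).comp
      (e.continuousAt_symm hp)
  refine h1.congr ?_
  filter_upwards [e.open_target.mem_nhds hp] with q hq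
  simp [e.right_inv hq]

theorem IsClosedHypersurface.continuous_of_isCk (hM : IsClosedHypersurface M) {F : Type*}
    [NormedAddCommGroup F] [NormedSpace ℝ F] {k : ℕ} {f : M → F} (hf : IsCk k f) : Continuous f :=
  hM.continuous_of_chart fun e he => (hf e he).continuousOn

theorem isCk_surfaceGrad (hθ : IsImmersion θ) {k : ℕ} (hk : k ≤ 1) {f : M → ℝ}
    (hf : IsCk (k + 1) f) : IsCk k (surfaceGrad θ f) := fun e he => by
  have h := contDiffOn_paramGrad (n := (k : WithTop ℕ∞)) (m := ((k + 1 : ℕ) : WithTop ℕ∞))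
    e.open_source ((hθ.isC2.of_le (k := k + 1) (by omega)) e he) (hθ.injective e he) (hf e he)
    (by push_cast; exact le_rfl)
  exact h.congr fun x hx => surfaceGrad_apply hθ (hf.of_le (by omega)) he hx

theorem isCk_unitNormal (hθ : IsImmersion θ) (hν : IsUnitNormal θ ν) : IsCk 1 ν := fun e he => by
  have h := contDiffOn_unitNormal (X := θ ∘ e) (ν := ν ∘ e) (by simp) e.open_source (hθ.isC2 e he)
    (hθ.injective e he) (hν.continuous.comp_continuousOn e.continuousOn)
    (fun x _ => hν.norm_eq_one _) (hν.orthogonal e he)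
  exact_mod_cast h

theorem surfaceDiv_apply (hθ : IsImmersion θ) {η : M → Euc (d + 1)} (hη : IsCk 1 η)
    (he : IsLocalParam e) {x : Euc d} (hx : x ∈ e.source) :
    surfaceDiv θ η (e x) = ctrace (pinv (fderiv ℝ (θ ∘ e) x) ∘L fderiv ℝ (η ∘ e) x) := by
  rw [surfaceDiv, ← sum_paramGrad_eq_ctrace (hθ.injective e he x hx)
    (hη.differentiableAt le_rfl he hx)]
  refine Finset.sum_congr rfl fun i _ => ?_
  rw [surfaceGrad_apply hθ (hη.apply i) he hx]
  rfl

theorem IsClosedHypersurface.continuous_surfaceGrad (hM : IsClosedHypersurface M)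
    (hθ : IsImmersion θ) {f : M → ℝ} (hf : IsCk 1 f) : Continuous (surfaceGrad θ f) :=
  hM.continuous_of_isCk (isCk_surfaceGrad (k := 0) hθ zero_le_one hf)

theorem IsClosedHypersurface.continuous_surfaceDiv (hM : IsClosedHypersurface M)
    (hθ : IsImmersion θ) {η : M → Euc (d + 1)} (hη : IsCk 1 η) : Continuous (surfaceDiv θ η) :=
  continuous_finsetSum _ fun i _ =>
    (EuclideanSpace.proj i : Euc (d + 1) →L[ℝ] ℝ).continuous.comp
      (hM.continuous_surfaceGrad hθ (hη.apply i))

theorem inner_surfaceGrad (hθ : IsImmersion θ) {f : M → ℝ} (hf : IsCk 1 f) (he : IsLocalParam e)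
    {x : Euc d} (hx : x ∈ e.source) (v : Euc (d + 1)) :
    ⟪surfaceGrad θ f (e x), v⟫ = fderiv ℝ (f ∘ e) x (pinv (fderiv ℝ (θ ∘ e) x) v) := by
  rw [surfaceGrad_apply hθ hf he hx, inner_paramGrad (hθ.injective e he x hx)]

theorem IsClosedHypersurface.surfaceGrad_eq_zero (hM : IsClosedHypersurface M)
    (hθ : IsImmersion θ) {f : M → ℝ} (hf : IsCk 1 f) {p : M} (h : f =ᶠ[𝓝 p] 0) :
    surfaceGrad θ f p = 0 := by
  obtain ⟨e, he, hp⟩ := hM.exists_param p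
  have hx := e.map_target hp
  refine ext_inner_right ℝ fun v => ?_
  have h1 : f ∘ e =ᶠ[𝓝 (e.symm p)] fun _ => 0 := by
    have h2 : Tendsto e (𝓝 (e.symm p)) (𝓝 p) := by
      have := e.continuousAt hx
      rwa [ContinuousAt, e.right_inv hp] at this
    exact h2.eventually h
  have h3 := inner_surfaceGrad hθ hf he hx v
  rw [e.right_inv hp, h1.fderiv_eq] at h3
  rw [h3]
  simp

theorem IsClosedHypersurface.sum_surfaceGrad_mul (hM : IsClosedHypersurface M)
    (hθ : IsImmersion θ) {ι : Type*} [Fintype ι] {ψ : ι → M → ℝ} (hψ : ∀ i, IsCk 1 (ψ i))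
    (hsum : ∀ p, ∑ i, ψ i p = 1) {f : M → ℝ} (hf : IsCk 1 f) (p : M) :
    ∑ i, surfaceGrad θ (fun q => ψ i q * f q) p = surfaceGrad θ f p := by
  obtain ⟨e, he, hp⟩ := hM.exists_param p
  have hx := e.map_target hp
  refine ext_inner_right ℝ fun v => ?_
  rw [sum_inner, ← e.right_inv hp]
  simp_rw [inner_surfaceGrad hθ ((hψ _).mul hf) he hx]
  rw [inner_surfaceGrad hθ hf he hx, ← sum_apply, ← fderiv_fun_sum
    fun i _ => ((hψ i).mul hf).differentiableAt le_rfl he hx]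
  congr 2
  funext y
  simp [← Finset.sum_mul, hsum]

/-- With `H = -div_Γ ν` the sign in `divOp_areaFactor` becomes positive; the gradient term comes
from differentiating the weight `f`. -/
theorem divOp_chart (hθ : IsImmersion θ) (hν : IsUnitNormal θ ν) (he : IsLocalParam e)
    {f : M → ℝ} (hf : IsCk 1 f) {x : Euc d} (hx : x ∈ e.source) (y : Euc (d + 1)) :
    divOp (fderiv ℝ (fun y => f (e y) • fderiv ℝ areaFactor (fderiv ℝ (θ ∘ e) y)) x) y =
      (⟪surfaceGrad θ f (e x), y⟫ + f (e x) * meanCurvature θ ν (e x) * ⟪ν (e x), y⟫) *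
        areaElement (θ ∘ e) x := by
  have hX := hθ.isC2 e he
  have hinj := hθ.injective e he
  have hC1 := isCk_unitNormal hθ hν
  have h1 := divOp_fderiv_smul_areaFactor e.open_source hX hinj hx
    (hf.differentiableAt le_rfl he hx) y
  have h2 := divOp_areaFactor (ν := ν ∘ e) (by simp) e.open_source hX hinj
    (fun x _ => hν.norm_eq_one _) (hν.orthogonal e he) hx (hC1.differentiableAt le_rfl he hx) y
  rw [h2] at h1
  refine h1.trans ?_
  rw [meanCurvature, surfaceDiv_apply hθ hC1 he hx, inner_surfaceGrad hθ hf he hx]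
  change _ = _ * areaFactor (fderiv ℝ (θ ∘ e) x)
  simp only [Function.comp]
  ring

theorem divOp_chart_tangential (hθ : IsImmersion θ) (he : IsLocalParam e)
    {f g : M → ℝ} (hf : IsCk 1 f) (hg : IsCk 1 g) {x : Euc d} (hx : x ∈ e.source) :
    divOp (fderiv ℝ (fun y => f (e y) • fderiv ℝ areaFactor (fderiv ℝ (θ ∘ e) y)) x)
      (surfaceGrad θ g (e x)) =
      ⟪surfaceGrad θ f (e x), surfaceGrad θ g (e x)⟫ * areaElement (θ ∘ e) x := by
  have hX := hθ.isC2 e he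
  have hinj := hθ.injective e he
  have h1 := divOp_fderiv_smul_areaFactor e.open_source hX hinj hx
    (hf.differentiableAt le_rfl he hx) (surfaceGrad θ g (e x))
  obtain ⟨v, hv⟩ := paramGrad_mem_range (X := θ ∘ e) (g ∘ e) x
  have h2 := divOp_areaFactor_tangential e.open_source hX hinj hx v
  rw [← hv, ← surfaceGrad_apply hθ hg he hx] at h2
  rw [h2, mul_zero, add_zero] at h1
  refine h1.trans ?_
  rw [inner_surfaceGrad hθ hf he hx, mul_comm]
  rfl

/-- Integration by parts with `P = f · (area variation)` and `η = ∇_Γ g`: `P (Dη)` is `f Δ_Γ g`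
times the area element, and since `η` is tangential its pairing with the adjoint has no curvature
term. -/
theorem setIntegral_green (hθ : IsImmersion θ) (he : IsLocalParam e) {K : Set (Euc d)}
    (hK : IsCompact K) (hKs : K ⊆ e.source) {f g : M → ℝ} (hf : IsCk 1 f) (hg : IsCk 2 g)
    (hf0 : ∀ p ∉ e '' K, f p = 0) :
    ∫ x in K, (⟪surfaceGrad θ f (e x), surfaceGrad θ g (e x)⟫ +
      f (e x) * laplaceBeltrami θ g (e x)) * areaElement (θ ∘ e) x = 0 := by
  have hX := hθ.isC2 e he
  have hinj := hθ.injective e he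
  have hZ : IsCk 1 (surfaceGrad θ g) := isCk_surfaceGrad hθ le_rfl hg
  have hΛ := contDiffOn_fderiv_areaFactor_comp e.open_source hX hinj
  have hP : ContDiffOn ℝ 1
      (fun y => f (e y) • fderiv ℝ areaFactor (fderiv ℝ (θ ∘ e) y)) e.source :=
    contDiffOn_smul_field (by exact_mod_cast hf e he) hΛ
  have hP0 : ∀ x ∈ e.source \ K,
      f (e x) • fderiv ℝ areaFactor (fderiv ℝ (θ ∘ e) x) = 0 := fun x hx => by
    rw [hf0, zero_smul]
    rintro ⟨y, hy, hyx⟩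
    exact hx.2 (e.injOn (hKs hy) hx.1 hyx ▸ hy)
  have hη : ContDiffOn ℝ 1 (surfaceGrad θ g ∘ e) e.source := by exact_mod_cast hZ e he
  have h := setIntegral_apply_fderiv_eq_neg_divOp (μ := volume) e.open_source hK hKs hP hP0 hη
  rw [eq_neg_iff_add_eq_zero, ← integral_add] at h
  · rw [← h]
    refine setIntegral_congr_fun hK.measurableSet fun x hx => ?_
    have h1 := divOp_chart_tangential hθ he hf (hg.of_le one_le_two) (hKs hx)
    simp only [Function.comp] at h1 ⊢
    rw [h1, smul_apply, fderiv_areaFactor_apply (hinj x (hKs hx)), laplaceBeltrami,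
      surfaceDiv_apply hθ hZ he (hKs hx), add_mul, add_comm]
    change _ = _ • (areaElement (θ ∘ e) x * _) + _
    simp only [smul_eq_mul]
    ring
  · exact ((hP.continuousOn.clm_apply (hη.continuousOn_fderiv_of_isOpen e.open_source
      (by simp))).mono hKs).integrableOn_compact hK
  · exact (((continuous_divOp.comp_continuousOn (hP.continuousOn_fderiv_of_isOpen e.open_source
      (by simp))).clm_apply hη.continuousOn).mono hKs).integrableOn_compact hK

theorem IsClosedHypersurface.isFiniteMeasure_areaMeasure (hM : IsClosedHypersurface M)
    (hθ : IsImmersion θ) : IsFiniteMeasure (areaMeasure θ) := by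
  obtain ⟨ι, _, e, K, ψ, h, hsum⟩ := hM.exists_partitionOfUnity
  refine ⟨?_⟩
  have hcover : (univ : Set M) ⊆ ⋃ i, e i '' K i := by
    intro p _
    by_contra hp
    have h0 : ∀ i, ψ i p = 0 := fun i =>
      ((h i).2.2.2.2 p fun hpi => hp (mem_iUnion.2 ⟨i, hpi⟩)).self_of_nhds
    have h1 := hsum p
    simp [h0] at h1
  refine (measure_mono hcover).trans_lt ((measure_iUnion_fintype_le _ _).trans_lt ?_)
  exact ENNReal.sum_lt_top.2 fun i _ =>
    areaMeasure_image_lt_top hθ (h i).1 (h i).2.1 (h i).2.2.1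

theorem IsClosedHypersurface.integrable_areaMeasure (hM : IsClosedHypersurface M)
    (hθ : IsImmersion θ) {f : M → ℝ} (hf : Continuous f) : Integrable f (areaMeasure θ) := by
  have := hM.isFiniteMeasure_areaMeasure hθ
  have : CompactSpace M := isCompact_iff_compactSpace.1 hM.isCompact
  exact hf.integrable_of_hasCompactSupport (HasCompactSupport.of_compactSpace f)

/-- The local formula is applied with `f = ψ i · u` and summed; the gradients of `ψ i · u` add up to
that of `u`. -/
theorem IsClosedHypersurface.integral_green (hM : IsClosedHypersurface M) (hθ : IsImmersion θ)
    {u : M → ℝ} (hu : IsCk 2 u) :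
    ∫ p, u p * laplaceBeltrami θ u p ∂(areaMeasure θ) =
      - ∫ p, ‖surfaceGrad θ u p‖ ^ 2 ∂(areaMeasure θ) := by
  obtain ⟨ι, _, e, K, ψ, h, hsum⟩ := hM.exists_partitionOfUnity
  have hu1 : IsCk 1 u := hu.of_le one_le_two
  have hψ : ∀ i, IsCk 1 (ψ i) := fun i => (h i).2.2.2.1.of_le one_le_two
  have hcu := hM.continuous_of_isCk hu
  have hcg := hM.continuous_surfaceGrad hθ hu1
  have hcl : Continuous (laplaceBeltrami θ u) :=
    hM.continuous_surfaceDiv hθ (isCk_surfaceGrad hθ le_rfl hu)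
  have hci : ∀ i, Continuous fun p => ⟪surfaceGrad θ (fun q => ψ i q * u q) p, surfaceGrad θ u p⟫ +
      ψ i p * u p * laplaceBeltrami θ u p := fun i =>
    ((hM.continuous_surfaceGrad hθ ((hψ i).mul hu1)).inner hcg).add
      (((hM.continuous_of_isCk (hψ i)).mul hcu).mul hcl)
  have h0 : ∀ i, ∫ p, (⟪surfaceGrad θ (fun q => ψ i q * u q) p, surfaceGrad θ u p⟫ +
      ψ i p * u p * laplaceBeltrami θ u p) ∂(areaMeasure θ) = 0 := fun i => by
    obtain ⟨he, hK, hKs, -, hz⟩ := h i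
    rw [integral_areaMeasure_eq hθ he hKs (hci i)]
    · refine setIntegral_green hθ he hK hKs ((hψ i).mul hu1) hu fun p hp => ?_
      simp [(hz p hp).self_of_nhds]
    · intro p hp
      have hz' : (fun q => ψ i q * u q) =ᶠ[𝓝 p] 0 := (hz p hp).mono fun q hq => by simp [hq]
      rw [hM.surfaceGrad_eq_zero hθ ((hψ i).mul hu1) hz', (hz p hp).self_of_nhds]
      simp
  have h1 : ∫ p, ∑ i, (⟪surfaceGrad θ (fun q => ψ i q * u q) p, surfaceGrad θ u p⟫ +
      ψ i p * u p * laplaceBeltrami θ u p) ∂(areaMeasure θ) = 0 := by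
    rw [integral_finsetSum _ fun i _ => hM.integrable_areaMeasure hθ (hci i)]
    exact Finset.sum_eq_zero fun i _ => h0 i
  have h2 : ∀ p, ∑ i, (⟪surfaceGrad θ (fun q => ψ i q * u q) p, surfaceGrad θ u p⟫ +
      ψ i p * u p * laplaceBeltrami θ u p) =
      u p * laplaceBeltrami θ u p + ‖surfaceGrad θ u p‖ ^ 2 := fun p => by
    rw [Finset.sum_add_distrib, ← sum_inner, hM.sum_surfaceGrad_mul hθ hψ hsum hu1,
      real_inner_self_eq_norm_sq, ← Finset.sum_mul, ← Finset.sum_mul, hsum]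
    ring
  simp_rw [h2] at h1
  have h3 := integral_add (hM.integrable_areaMeasure hθ (hcu.mul hcl))
    (hM.integrable_areaMeasure hθ (hcg.norm.pow 2))
  exact eq_neg_of_add_eq_zero_left (h3.symm.trans h1)

end SurfaceCalculus

/-! ### Time derivative of the energy -/

section Energy

variable {d : ℕ} {M : Set (Euc (d + 1))} {T t : ℝ} {θ ν : ℝ → M → Euc (d + 1)}
  {c : ℝ → M → ℝ} {G : ℝ → ℝ}

theorem hasDerivWithinAt_setIntegral_chart (hT : 0 < T) (hθ : IsEvolvingImmersed T θ)
    (hν : IsEvolvingNormal T θ ν) (hc1 : IsC1C0 T c) (hc2 : IsC0C2 T c) (hG : ContDiff ℝ 1 G)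
    {e : OpenPartialHomeomorph (Euc d) M} (he : IsLocalParam e) {K : Set (Euc d)}
    (hK : IsCompact K) (hKs : K ⊆ e.source) {ψ : M → ℝ} (hψ : IsCk 1 ψ)
    (hψ0 : ∀ p ∉ e '' K, ψ p = 0) (ht : t ∈ Icc 0 T) :
    HasDerivWithinAt
      (fun s => ∫ x in K, (ψ (e x) * G (c s (e x))) * areaElement (θ s ∘ e) x)
      (∫ x in K, (ψ (e x) * (deriv G (c t (e x)) * timeDeriv T c t (e x)) -
        (⟪surfaceGrad (θ t) (fun q => ψ q * G (c t q)) (e x), timeDeriv T θ t (e x)⟫ +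
          ψ (e x) * G (c t (e x)) * meanCurvature (θ t) (ν t) (e x) *
            ⟪ν t (e x), timeDeriv T θ t (e x)⟫)) * areaElement (θ t ∘ e) x) (Icc 0 T) t := by
  have hX : ∀ s ∈ Icc 0 T, ContDiffOn ℝ 2 (θ s ∘ e) e.source := fun s hs =>
    (hθ.isImmersion s hs).isC2 e he
  have hinj := (hθ.isImmersion t ht).injective e he
  have hcA : ContinuousOn (fderiv ℝ (θ t ∘ e)) e.source :=
    (hX t ht).continuousOn_fderiv_of_isOpen e.open_source (by norm_num)
  set C := fderiv ℝ (θ t ∘ e) '' K with hCdef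
  have hC : IsCompact C := hK.image_of_continuousOn (hcA.mono hKs)
  -- The area factor is smooth only at injective maps, while the variation argument needs a
  -- Lagrangian that is `C²` everywhere. Agreement near the compact set `C` of differentials at time
  -- `t` suffices.
  obtain ⟨L, hL, hLa⟩ := exists_contDiff_eventuallyEq_nhdsSet (n := 2) isOpen_setOf_injective hC
    (by rintro _ ⟨x, hx, rfl⟩; exact hinj x (hKs hx))
    (fun A hA => (contDiffAt_areaFactor hA).contDiffWithinAt)
  have hφ : ContDiffOn ℝ 1 (ψ ∘ e) e.source := by exact_mod_cast hψ e he
  have hφ0 : ∀ x ∈ e.source \ K, (ψ ∘ e) x = 0 := fun x hx => hψ0 _ fun ⟨y, hy, hyx⟩ =>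
    hx.2 (e.injOn (hKs hy) hx.1 hyx ▸ hy)
  have hu : ∀ s ∈ Icc 0 T, ContDiffOn ℝ 1 (c s ∘ e) e.source := fun s hs =>
    (hc2.1 s hs e he).of_le (by norm_num)
  have hq : ContinuousOn (timeDeriv T c t ∘ e) K :=
    ((hc1.continuous_timeDeriv hT ht).comp_continuousOn e.continuousOn).mono hKs
  have hY : ContinuousOn (timeDeriv T θ t ∘ e) K :=
    ((hθ.isC1C0.continuous_timeDeriv hT ht).comp_continuousOn e.continuousOn).mono hKs
  have hX1 := hθ.isC0C2.tendstoUniformlyOn_fderiv he hK hKs ht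
  have hmain := hasDerivWithinAt_setIntegral_lagrangian (μ := volume) (L := L) hG
    (by exact_mod_cast hL) e.open_source hK hKs hφ hφ0 ht hu hX
    (hc2.tendstoUniformlyOn he hK hKs ht) (hc2.tendstoUniformlyOn_fderiv he hK hKs ht)
    hX1 (hθ.isC0C2.tendstoUniformlyOn_fderiv_fderiv he hK hKs ht) hq hY
    (hc1.tendstoUniformlyOn_slope hT ht) (hθ.isC1C0.tendstoUniformlyOn_slope hT ht)
  obtain ⟨N, hNo, hCN, hN⟩ := mem_nhdsSet_iff_exists.1 hLa
  -- For `s` close to `t` the differentials on `K` stay in the neighbourhood of `C` where `L` is the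
  -- area factor.
  have hev : ∀ᶠ s in 𝓝[Icc 0 T] t, ∀ x ∈ K, L (fderiv ℝ (θ s ∘ e) x) =
      areaFactor (fderiv ℝ (θ s ∘ e) x) := by
    obtain ⟨δ, hδ, hδN⟩ := hC.exists_thickening_subset_open hNo hCN
    filter_upwards [Metric.tendstoUniformlyOn_iff.1 hX1 δ hδ] with s hs x hx
    refine hN (hδN (Metric.mem_thickening_iff.2 ⟨_, mem_image_of_mem _ hx, ?_⟩))
    rw [dist_comm]
    exact hs x hx
  have hLx : ∀ x ∈ K, L =ᶠ[𝓝 (fderiv ℝ (θ t ∘ e) x)] areaFactor := fun x hx =>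
    mem_of_superset (hNo.mem_nhds (hCN (mem_image_of_mem _ hx))) hN
  refine (hmain.congr_of_eventuallyEq_of_mem ?_ ht).congr_deriv ?_
  · filter_upwards [hev] with s hs
    refine setIntegral_congr_fun hK.measurableSet fun x hx => ?_
    rw [hs x hx, ← mul_assoc]
    rfl
  · refine setIntegral_congr_fun hK.measurableSet fun x hx => ?_
    -- Equality near `x` is required, since the momentum is differentiated next.
    have hmom : momentum G L (ψ ∘ e) (c t ∘ e) (fderiv ℝ (θ t ∘ e)) =ᶠ[𝓝 x]
        fun y => (ψ (e y) * G (c t (e y))) • fderiv ℝ areaFactor (fderiv ℝ (θ t ∘ e) y) := by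
      have h1 := (hcA.continuousAt (e.open_source.mem_nhds (hKs hx))).eventually
        ((hLx x hx).fderiv (𝕜 := ℝ))
      filter_upwards [h1] with y hy
      simp only [momentum, hy, Function.comp]
    have hGc : IsCk 1 (fun q => ψ q * G (c t q)) :=
      hψ.mul (((hc2.1 t ht).of_le one_le_two).comp_contDiff (by exact_mod_cast hG))
    rw [hmom.fderiv_eq, divOp_chart (hθ.isImmersion t ht) (hν.isUnitNormal t ht) he hGc (hKs hx),
      (hLx x hx).self_of_nhds]
    change _ * areaElement (θ t ∘ e) x - _ = _
    simp only [Function.comp]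
    ring

theorem IsClosedHypersurface.continuous_meanCurvature (hM : IsClosedHypersurface M)
    {θ ν : M → Euc (d + 1)} (hθ : IsImmersion θ) (hν : IsUnitNormal θ ν) :
    Continuous (meanCurvature θ ν) :=
  (hM.continuous_surfaceDiv hθ (isCk_unitNormal hθ hν)).neg

theorem IsClosedHypersurface.hasDerivWithinAt_energy (hM : IsClosedHypersurface M) (hT : 0 < T)
    (hθ : IsEvolvingImmersed T θ) (hν : IsEvolvingNormal T θ ν) (hc1 : IsC1C0 T c)
    (hc2 : IsC0C2 T c) (hG : ContDiff ℝ 1 G) (ht : t ∈ Icc 0 T) :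
    HasDerivWithinAt (energy G θ c)
      (∫ p, (deriv G (c t p) * timeDeriv T c t p -
        (⟪surfaceGrad (θ t) (fun q => G (c t q)) p, timeDeriv T θ t p⟫ +
          G (c t p) * meanCurvature (θ t) (ν t) p * normalVelocity T θ ν t p))
        ∂(areaMeasure (θ t))) (Icc 0 T) t := by
  obtain ⟨ι, _, e, K, ψ, h, hsum⟩ := hM.exists_partitionOfUnity
  have hψ : ∀ i, IsCk 1 (ψ i) := fun i => (h i).2.2.2.1.of_le one_le_two
  have hcψ : ∀ i, Continuous (ψ i) := fun i => hM.continuous_of_isCk (hψ i)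
  have hψ0 : ∀ i, ∀ p ∉ e i '' K i, ψ i p = 0 := fun i p hp => ((h i).2.2.2.2 p hp).self_of_nhds
  have hGc : ∀ s ∈ Icc 0 T, Continuous fun p => G (c s p) := fun s hs =>
    hG.continuous.comp (hc1.continuous hs)
  have hE : ∀ s ∈ Icc 0 T, energy G θ c s = ∑ i, ∫ x in K i,
      (ψ i (e i x) * G (c s (e i x))) * areaElement (θ s ∘ e i) x := fun s hs => by
    have h1 : ∀ i, ∫ p, ψ i p * G (c s p) ∂(areaMeasure (θ s)) = ∫ x in K i,
        (ψ i (e i x) * G (c s (e i x))) * areaElement (θ s ∘ e i) x := fun i =>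
      integral_areaMeasure_eq (hθ.isImmersion s hs) (h i).1 (h i).2.2.1 ((hcψ i).mul (hGc s hs))
        fun p hp => by simp [hψ0 i p hp]
    simp_rw [← h1]
    refine Eq.trans ?_ (integral_finsetSum _ fun i _ =>
      hM.integrable_areaMeasure (hθ.isImmersion s hs) ((hcψ i).mul (hGc s hs)))
    refine integral_congr_ae (Eventually.of_forall fun p => ?_)
    change _ = ∑ i, ψ i p * G (c s p)
    rw [← Finset.sum_mul, hsum, one_mul]
  have hθt := hθ.isImmersion t ht
  have hGk : IsCk 1 (fun q => G (c t q)) :=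
    ((hc2.1 t ht).of_le one_le_two).comp_contDiff (by exact_mod_cast hG)
  have hcθ := hθ.isC1C0.continuous_timeDeriv hT ht
  have hcc := hc1.continuous_timeDeriv hT ht
  have hcG' : Continuous fun p => deriv G (c t p) :=
    (hG.continuous_deriv (by simp)).comp (hc1.continuous ht)
  have hcH := hM.continuous_meanCurvature hθt (hν.isUnitNormal t ht)
  have hcν := (hν.isUnitNormal t ht).continuous
  let k : ι → M → ℝ := fun i p => ψ i p * (deriv G (c t p) * timeDeriv T c t p) -
        (⟪surfaceGrad (θ t) (fun q => ψ i q * G (c t q)) p, timeDeriv T θ t p⟫ +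
          ψ i p * G (c t p) * meanCurvature (θ t) (ν t) p * ⟪ν t p, timeDeriv T θ t p⟫)
  have hck : ∀ i, Continuous (k i) := fun i =>
    ((hcψ i).mul (hcG'.mul hcc)).sub
      (((hM.continuous_surfaceGrad hθt ((hψ i).mul hGk)).inner hcθ).add
        ((((hcψ i).mul (hGc t ht)).mul hcH).mul (hcν.inner hcθ)))
  have hk : ∀ i, ∫ p, k i p ∂(areaMeasure (θ t)) =
      ∫ x in K i, k i (e i x) * areaElement (θ t ∘ e i) x := fun i => by
    refine integral_areaMeasure_eq hθt (h i).1 (h i).2.2.1 (hck i) fun p hp => ?_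
    have hz : (fun q => ψ i q * G (c t q)) =ᶠ[𝓝 p] 0 :=
      ((h i).2.2.2.2 p hp).mono fun q hq => by simp [hq]
    simp only [k]
    rw [hM.surfaceGrad_eq_zero hθt ((hψ i).mul hGk) hz, hψ0 i p hp]
    simp
  have hder := HasDerivWithinAt.fun_sum (u := Finset.univ) fun i _ =>
    hasDerivWithinAt_setIntegral_chart hT hθ hν hc1 hc2 hG (h i).1 (h i).2.1 (h i).2.2.1 (hψ i)
      (hψ0 i) ht
  refine (hder.congr hE (hE t ht)).congr_deriv ?_
  refine (Finset.sum_congr rfl fun i _ => (hk i).symm).trans ?_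
  rw [← integral_finsetSum _ fun i _ => hM.integrable_areaMeasure hθt (hck i)]
  refine integral_congr_ae (Eventually.of_forall fun p => ?_)
  simp only [k, normalVelocity]
  rw [Finset.sum_sub_distrib, Finset.sum_add_distrib, ← sum_inner,
    hM.sum_surfaceGrad_mul hθt hψ hsum hGk]
  simp_rw [mul_assoc (ψ _ p)]
  rw [← Finset.sum_mul, ← Finset.sum_mul, hsum, real_inner_comm (ν t p)]
  ring

theorem IsClosedHypersurface.surfaceGrad_comp (hM : IsClosedHypersurface M)
    {θ : M → Euc (d + 1)} (hθ : IsImmersion θ) (hG : ContDiff ℝ 1 G) {f : M → ℝ} (hf : IsCk 1 f)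
    (p : M) : surfaceGrad θ (fun q => G (f q)) p = deriv G (f p) • surfaceGrad θ f p := by
  obtain ⟨e, he, hp⟩ := hM.exists_param p
  have hx := e.map_target hp
  refine ext_inner_right ℝ fun v => ?_
  rw [inner_smul_left, ← e.right_inv hp, inner_surfaceGrad hθ
    (hf.comp_contDiff (by exact_mod_cast hG)) he hx, inner_surfaceGrad hθ hf he hx]
  have h1 : HasDerivAt G (deriv G ((f ∘ e) (e.symm p))) ((f ∘ e) (e.symm p)) :=
    (hG.differentiable (by simp) _).hasDerivAt
  have h2 := h1.comp_hasFDerivAt _ (hf.differentiableAt le_rfl he hx).hasFDerivAt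
  have h3 : fderiv ℝ ((fun q => G (f q)) ∘ e) (e.symm p) = _ := h2.fderiv
  rw [h3]
  simp

end Energy

end SurfaceFlow

/-! ### The energy identity and monotonicity -/

theorem mainTheorem6 (d : ℕ) (hd : 0 < d)
    (G : ℝ → ℝ) (hG : ContDiff ℝ 3 G)
    (M : Set (SurfaceFlow.Euc (d + 1))) (hM : SurfaceFlow.IsClosedHypersurface M)
    (T : ℝ) (hT : 0 < T)
    (θ ν : ℝ → M → SurfaceFlow.Euc (d + 1)) (c : ℝ → M → ℝ)
    (hsol : SurfaceFlow.IsSolution G T θ ν c) :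
    AntitoneOn (SurfaceFlow.energy G θ c) (Icc 0 T) ∧
    ∀ t ∈ Icc 0 T,
      Integrable (fun p => G (c t p)) (SurfaceFlow.areaMeasure (θ t)) ∧
      Integrable (SurfaceFlow.dissipation G T θ ν c t) (SurfaceFlow.areaMeasure (θ t)) ∧
      HasDerivWithinAt (SurfaceFlow.energy G θ c)
        (- ∫ p, SurfaceFlow.dissipation G T θ ν c t p ∂(SurfaceFlow.areaMeasure (θ t)))
        (Icc 0 T) t := by
  open SurfaceFlow in
  have hG1 : ContDiff ℝ 1 G := hG.of_le (by norm_num)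
  have hG2 : ContDiff ℝ 2 (deriv G) :=
    (contDiff_succ_iff_deriv.1 (show ContDiff ℝ (2 + 1) G by norm_num; exact hG)).2.2
  have key : ∀ t ∈ Icc 0 T,
      Integrable (fun p => G (c t p)) (areaMeasure (θ t)) ∧
      Integrable (dissipation G T θ ν c t) (areaMeasure (θ t)) ∧
      HasDerivWithinAt (energy G θ c)
        (- ∫ p, dissipation G T θ ν c t p ∂(areaMeasure (θ t))) (Icc 0 T) t := by
    intro t ht
    have hθt := hsol.evolving.isImmersion t ht
    have hc2 := hsol.isC0C2.1 t ht
    have hc1 : IsCk 1 (c t) := hc2.of_le one_le_two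
    have hu : IsCk 2 (fun q => deriv G (c t q)) := hc2.comp_contDiff (by exact_mod_cast hG2)
    have hcg := hM.continuous_surfaceGrad hθt (hu.of_le one_le_two)
    have hcu := hM.continuous_of_isCk hu
    have hcl : Continuous (laplaceBeltrami (θ t) fun q => deriv G (c t q)) :=
      hM.continuous_surfaceDiv hθt (isCk_surfaceGrad hθt le_rfl hu)
    have hcV : Continuous (normalVelocity T θ ν t) :=
      (hsol.evolving.isC1C0.continuous_timeDeriv hT ht).inner
        (hsol.normal.isUnitNormal t ht).continuous
    have hi1 := hM.integrable_areaMeasure hθt (hcg.norm.pow 2)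
    have hi2 := hM.integrable_areaMeasure hθt (hcV.pow 2)
    refine ⟨hM.integrable_areaMeasure hθt (hG.continuous.comp (hsol.isC1C0.continuous ht)),
      hi1.add hi2, ?_⟩
    refine (hM.hasDerivWithinAt_energy hT hsol.evolving hsol.normal hsol.isC1C0 hsol.isC0C2 hG1
      ht).congr_deriv ?_
    -- The two equations enter here pointwise: the diffusion equation is multiplied by `G'(c)`, and
    -- one factor of `V²` is replaced by `(G(c) - G'(c) c) H`, so that all terms with `H V` cancel.
    have hint : ∀ p, deriv G (c t p) * timeDeriv T c t p -
        (⟪surfaceGrad (θ t) (fun q => G (c t q)) p, timeDeriv T θ t p⟫ +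
          G (c t p) * meanCurvature (θ t) (ν t) p * normalVelocity T θ ν t p) =
        deriv G (c t p) * laplaceBeltrami (θ t) (fun q => deriv G (c t q)) p -
          normalVelocity T θ ν t p ^ 2 := fun p => by
      have h1 := hsol.velocity_eq t ht p
      have h2 := hsol.diffusion_eq t ht p
      rw [normalTimeDeriv] at h2
      rw [hM.surfaceGrad_comp hθt hG1 hc1, inner_smul_left, real_inner_comm, pow_two]
      nth_rewrite 2 [h1]
      simp only [conj_trivial]
      linear_combination deriv G (c t p) * h2
    simp_rw [hint]
    refine (integral_sub (hM.integrable_areaMeasure hθt (hcu.mul hcl)) hi2).trans ?_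
    refine (congrArg (· - _) (hM.integral_green hθt hu)).trans ?_
    rw [← neg_add']
    exact congrArg Neg.neg (integral_add hi1 hi2).symm
  refine ⟨?_, key⟩
  refine antitoneOn_of_hasDerivWithinAt_nonpos (convex_Icc 0 T)
    (fun t ht => (key t ht).2.2.continuousWithinAt)
    (fun t ht => (key t (interior_subset ht)).2.2.mono interior_subset) fun t _ => ?_
  exact neg_nonpos.2 (integral_nonneg fun p => add_nonneg (sq_nonneg _) (sq_nonneg _))
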